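/- There are absolute constants $c,c_0>0$ such that the following holds. Let $k\ge 2$, $n\ge 1$, $d$ be integers, $\alpha\in(0,1)$, and $\delta>0$ with $\delta n$ an integer. Let $[n]$ be partitioned into clusters $C_1,\dots,C_k$ with $|C_\ell|\ge\delta n$ for all $\ell$, let $M_1,\dots,M_k\in\mathbb R^d$ be the cluster centers, put $P_j=M_\ell$ for $j\in C_\ell$, and let $A_1,\dots,A_n\in\mathbb R^d$ be data points. Put $\sigma=\|\mathbf A-\mathbf P\|/\sqrt n$, where $\|\cdot\|$ is the spectral norm and $\mathbf A,\mathbf P$ are the $d\times n$ matrices with columns $A_j,P_j$. Assume 1. (well-separatedness) for every $\ell$, the component of $M_\ell$ orthogonal to the span of the vectors $M_{\ell'}$, $\ell'\neq\ell$, has length at least $\alpha\max_{\ell'}|M_{\ell'}|$; 2. (spectrally bounded perturbations) $\dfrac{\sigma}{\sqrt\delta}\le\dfrac{\alpha^3\min_\ell|M_\ell|}{4500\,k^9}$. An adversary chooses subsets $S_\ell\subseteq C_\ell$ with $|S_\ell|=\delta n$ for each $\ell$ and vectors $\Delta_1,\dots,\Delta_n\in\mathbb R^d$ such that $P_j+\Delta_j$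 lies in the convex hull of $M_1,\dots,M_k$ for all $j$, and $|\Delta_j|\le 4\sigma/\sqrt\delta$ for all $j\in S_1\cup\dots\cup S_k$. The observed points are $\widetilde A_j=A_j+\Delta_j$, the columns of a matrix $\widetilde{\mathbf A}$. For $S\subseteq[n]$ write $\widetilde A_S=\frac1{|S|}\sum_{j\in S}\widetilde A_j$. Run the following algorithm (LKS) on $\widetilde{\mathbf A}$, $k$, $\delta$ and a number $t\ge c_0\log d$ of power iterations. Subspace power method: let $Q_0$ be a random $d\times k$ matrix with orthonormal columns (the Gram–Schmidt orthonormalization of a matrix with independent standard Gaussian entries), for $s=1,\dots,t$ let $Q_s$ be the Gram–Schmidt orthonormalization of $\widetilde{\mathbf A}\widetilde{\mathbf A}^{T}Q_{s-1}$, and let $V$ be the column span of $Q_t$. Then, for $r=0,1,\dots,k-1$, pick a uniformly random unit vector $u$ (independently of the earlier choices) in the subspace $U$ of those vectors in $V$ that are orthogonal to $\widetilde A_{R_1},\dots,\widetilde A_{R_r}$, and let $R_{r+1}$ be a set $S\subseteq[n]$ with $|S|=\delta n$ that maximizes $|u\cdot \widetilde A_S|$ (ties broken arbitrarily; in the degenerate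 case $U=\{0\}$ take $u=0$). Then, with probability at least $1-c/\sqrt k$, the returned sets $R_1,\dots,R_k$, each of cardinality $\delta n$, recover the original centers: after a permutation of $M_1,\dots,M_k$, $$|\widetilde A_{R_\ell}-M_\ell|\le\frac{150\,k^4}{\alpha}\,\frac{\sigma}{\sqrt\delta}\qquad\text{for }\ell=1,\dots,k .$$ -/

import Mathlib

noncomputable section

namespace LatentSimplex

/-- Points of `ℝ^d` with the Euclidean norm. -/
abbrev Pt (d : ℕ) : Type := EuclideanSpace ℝ (Fin d)

/-- The linear map `x ↦ ∑ j, x j • B j` from `ℝ^n` to `ℝ^d`, that is, the `d × n` matrix whose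
`j`-th column is `B j`. -/
def colMap {d n : ℕ} (B : Fin n → Pt d) : EuclideanSpace ℝ (Fin n) →L[ℝ] Pt d :=
  ∑ j, (EuclideanSpace.proj j : EuclideanSpace ℝ (Fin n) →L[ℝ] ℝ).smulRight (B j)

theorem colMap_apply {d n : ℕ} (B : Fin n → Pt d) (x : EuclideanSpace ℝ (Fin n)) :
    colMap B x = ∑ j, x j • B j := by
  simp [colMap]

/-- `σ = ‖A - P‖ / √n`, where `‖·‖` is the spectral norm. -/
def sigma {d n : ℕ} (A P : Fin n → Pt d) : ℝ :=
  ‖colMap (fun j => A j - P j)‖ / Real.sqrt n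

/-- The average `A_S` of the points `A j`, `j ∈ S`. -/
def avg {d n : ℕ} (A : Fin n → Pt d) (S : Finset (Fin n)) : Pt d :=
  (S.card : ℝ)⁻¹ • ∑ j ∈ S, A j

/-- Well-separatedness: for every `ℓ`, the component of `M ℓ` orthogonal to the span of the other
`M ℓ'` has length at least `α * max_ℓ' ‖M ℓ'‖`. -/
def WellSeparated {d k : ℕ} (M : Fin k → Pt d) (α : ℝ) : Prop :=
  ∀ ℓ ℓ' : Fin k,
    α * ‖M ℓ'‖ ≤ ‖(Submodule.span ℝ (M '' {i | i ≠ ℓ}))ᗮ.starProjection (M ℓ)‖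

/-- Spectrally bounded perturbations:
`σ / √δ ≤ α ^ 3 * min_ℓ ‖M ℓ‖ / (4500 * k ^ 9)`. -/
def SpectrallyBounded {d k : ℕ} (M : Fin k → Pt d) (α δ σ : ℝ) : Prop :=
  ∀ ℓ : Fin k, σ / Real.sqrt δ ≤ α ^ 3 * ‖M ℓ‖ / (4500 * (k : ℝ) ^ 9)

/-- The iterates `Q_t` of the subspace power method: `Q_0` is the Gram-Schmidt orthonormalization
of the columns `G`, and `Q_{t+1}` that of the columns of `A Aᵀ Q_t`. -/
def powerIter {d n k : ℕ} (A : Fin n → Pt d) (G : Fin k → Pt d) : ℕ → Fin k → Pt d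
  | 0 => InnerProductSpace.gramSchmidtNormed ℝ G
  | t + 1 => InnerProductSpace.gramSchmidtNormed ℝ
      (fun ℓ => (colMap A) ((ContinuousLinearMap.adjoint (colMap A)) (powerIter A G t ℓ)))

/-- The subspace `U = V ∩ Null(A_{R_1}, …, A_{R_r})` used in round `r` (rounds counted from `0`),
where `V` is the span of the `t`-th iterate of the subspace power method. -/
def roundSpace {d n k : ℕ} (A : Fin n → Pt d) (t : ℕ) (G : Fin k → Pt d)
    (R : Fin k → Finset (Fin n)) (r : Fin k) : Submodule ℝ (Pt d) :=
  Submodule.span ℝ (Set.range (powerIter A G t)) ⊓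
    (Submodule.span ℝ ((fun s => avg A (R s)) '' {s | s < r}))ᗮ

/-- The random direction `u` of round `r`: the normalized orthogonal projection of `g r` to the
space of the round. For a standard Gaussian `g r` (independent of that space) it is uniform on the
unit sphere of the space. -/
def roundDir {d n k : ℕ} (A : Fin n → Pt d) (t : ℕ) (G g : Fin k → Pt d)
    (R : Fin k → Finset (Fin n)) (r : Fin k) : Pt d :=
  NormedSpace.normalize ((roundSpace A t G R r).starProjection (g r))

/-- `R` is a possible output of the algorithm LKS on the data `A`, with subset size `m = δ n`, `t`
power iterations and random bits `ω = (G, g)`: in each round `r`, the set `R r` is a maximizer of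
`|u ⬝ A_S|` over the `m`-element subsets `S`. Ties may be broken in any way. -/
def IsRun {d n k : ℕ} (A : Fin n → Pt d) (m t : ℕ)
    (ω : (Fin k → Pt d) × (Fin k → Pt d)) (R : Fin k → Finset (Fin n)) : Prop :=
  ∀ r : Fin k, (R r).card = m ∧
    ∀ S : Finset (Fin n), S.card = m →
      |inner ℝ (roundDir A t ω.1 ω.2 R r) (avg A S)| ≤
        |inner ℝ (roundDir A t ω.1 ω.2 R r) (avg A (R r))|

/-- The law of the random bits of LKS: independent standard Gaussian vectors in `ℝ^d`, namely the
`k` columns `G` of the initial matrix of the subspace power method (whose Gram-Schmidt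
orthonormalization is then a uniformly random `d × k` matrix with orthonormal columns) and the
vectors `g` of the `k` rounds. -/
def bitsLaw (d k : ℕ) : MeasureTheory.Measure ((Fin k → Pt d) × (Fin k → Pt d)) :=
  (MeasureTheory.Measure.pi fun _ : Fin k => ProbabilityTheory.stdGaussian (Pt d)).prod
    (MeasureTheory.Measure.pi fun _ : Fin k => ProbabilityTheory.stdGaussian (Pt d))

/-- With the random bits `ω`, LKS has an output, and each of its possible outputs `R_1, …, R_k`
satisfies `‖A_{R_ℓ} - M_ℓ‖ ≤ ε` for all `ℓ`, up to a permutation. -/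
def Recovers {d n k : ℕ} (A : Fin n → Pt d) (m t : ℕ) (M : Fin k → Pt d) (ε : ℝ)
    (ω : (Fin k → Pt d) × (Fin k → Pt d)) : Prop :=
  (∃ R, IsRun A m t ω R) ∧
    ∀ R, IsRun A m t ω R →
      ∃ π : Equiv.Perm (Fin k), ∀ ℓ, ‖avg A (R ℓ) - M (π ℓ)‖ ≤ ε

end LatentSimplex

end

/-! Put s = σ/√δ, μ = max ‖M ℓ‖, m = δn. The observed matrix is B + (A - P), where the columns of B
= P + Δ lie in the simplex of the centers and ‖A - P‖ = s√m. Testing A - P on indicator vectors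
shows that every average of m observed points is within s of the simplex, and that the average over
S ℓ is within 5s of M ℓ.

Well-separatedness yields unit vectors e ℓ orthogonal to all centers but M ℓ, with e ℓ ⬝ M ℓ ≥ αμ.
Hence the transposed observed matrix stretches the span T of the centers by at least √m(αμ/k - 5s),
and Tᗮ by at most s√m. By this gap the power iterates span a space V close to T as soon as the
Gaussian start is well conditioned with respect to the top singular space
(`exists_good_start_subspace`); t ≥ log d makes the influence of the start negligible. The start is
bad with probability at most 2/√k.

In a round, let F be the centers already found and U the part of V orthogonal to their
approximations. For ℓ ∉ F the vectors M ℓ and M ℓ ± M ℓ' have projections to U of length at least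
αμ/2 (`IsDualFamily.le_norm_starProjection`). By a small-ball estimate all their inner products with
u exceed τ = αμ/k⁴ in absolute value, except with probability 12/k^(3/2). Then one new center beats
all others by τ, and a maximizing average can put weight at most 6s/τ on the other vertices
(`exists_center_near_maximizers`). The k rounds together cost 12/√k.

Ties are the subtle point, since all outputs must be good at once. Almost surely, tied choices have
the same projection to U up to sign, so the next subspace is determined by the random bits and the
rounds can be handled by induction (`pi_stdGaussian_failSet_le`). -/

noncomputable section

namespace LatentSimplex

open MeasureTheory ProbabilityTheory


/-! ### Small-ball and moment estimates for the standard Gaussian. -/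

section Gaussian

variable {E : Type*} [NormedAddCommGroup E] [InnerProductSpace ℝ E] [FiniteDimensional ℝ E]
  [MeasurableSpace E] [BorelSpace E]

/-- The density is at most 1/√(2π) ≤ 1/2 and the interval has length 2s. -/
theorem gaussianReal_abs_le (s : ℝ) :
    gaussianReal 0 1 {z | |z| ≤ s} ≤ ENNReal.ofReal s := by
  have hset : {z : ℝ | |z| ≤ s} = Set.Icc (-s) s := by
    ext z; simp [abs_le]
  rw [hset, gaussianReal_apply _ one_ne_zero]
  have hpdf : ∀ x, gaussianPDF 0 1 x ≤ ENNReal.ofReal (1 / 2) := by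
    intro x
    refine ENNReal.ofReal_le_ofReal ?_
    rw [gaussianPDFReal]
    have h2 : (2 : ℝ) ≤ √(2 * Real.pi * ((1 : NNReal) : ℝ)) := by
      apply Real.le_sqrt_of_sq_le
      have := Real.pi_gt_three
      norm_num
      linarith
    have h1 : (√(2 * Real.pi * ((1 : NNReal) : ℝ)))⁻¹ ≤ 1 / 2 := by
      rw [one_div]
      exact inv_anti₀ (by norm_num) h2
    have h3 : Real.exp (-(x - 0) ^ 2 / (2 * ((1 : NNReal) : ℝ))) ≤ 1 := by
      rw [Real.exp_le_one_iff]
      have := sq_nonneg (x - 0)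
      norm_num
      nlinarith
    calc _ ≤ (1 / 2 : ℝ) * 1 := mul_le_mul h1 h3 (Real.exp_pos _).le (by norm_num)
      _ = 1 / 2 := by norm_num
  calc ∫⁻ x in Set.Icc (-s) s, gaussianPDF 0 1 x
      ≤ ∫⁻ _ in Set.Icc (-s) s, ENNReal.ofReal (1 / 2) := lintegral_mono fun x => hpdf x
    _ = ENNReal.ofReal (1 / 2) * ENNReal.ofReal (s - -s) := by simp
    _ = ENNReal.ofReal s := by
      rw [← ENNReal.ofReal_mul (by norm_num)]
      congr 1
      ring

theorem map_inner_stdGaussian {e : E} (he : ‖e‖ = 1) :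
    (stdGaussian E).map (fun g => inner ℝ e g) = gaussianReal 0 1 := by
  have h := IsGaussian.map_eq_gaussianReal (μ := stdGaussian E) (innerSL ℝ e)
  rw [integral_strongDual_stdGaussian, variance_dual_stdGaussian, innerSL_apply_norm, he] at h
  simpa using! h

theorem stdGaussian_abs_inner_le {x : E} (hx : x ≠ 0) (s : ℝ) :
    stdGaussian E {g | |inner ℝ x g| ≤ s} ≤ ENNReal.ofReal (s / ‖x‖) := by
  have hx0 : 0 < ‖x‖ := norm_pos_iff.2 hx
  have he : ‖‖x‖⁻¹ • x‖ = 1 := by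
    rw [norm_smul, norm_inv, norm_norm, inv_mul_cancel₀ hx0.ne']
  have hset : {g : E | |inner ℝ x g| ≤ s} =
      (fun g => inner ℝ (‖x‖⁻¹ • x) g) ⁻¹' {z | |z| ≤ s / ‖x‖} := by
    ext g
    simp only [Set.mem_ofPred_eq, Set.mem_preimage, real_inner_smul_left, abs_mul, abs_inv, abs_norm]
    rw [le_div_iff₀ hx0, mul_right_comm, inv_mul_cancel₀ hx0.ne', one_mul]
  rw [hset, ← Measure.map_apply (by fun_prop) (measurableSet_le (by fun_prop) (by fun_prop)),
    map_inner_stdGaussian he]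
  exact gaussianReal_abs_le _

theorem integral_inner_sq_stdGaussian (x : E) :
    ∫ g, (inner ℝ x g) ^ 2 ∂stdGaussian E = ‖x‖ ^ 2 := by
  have h := variance_dual_stdGaussian (innerSL ℝ x)
  rw [variance_eq_integral (by fun_prop), integral_strongDual_stdGaussian] at h
  simpa using! h

theorem integrable_norm_sq_stdGaussian (L : E →L[ℝ] E) :
    Integrable (fun g => ‖L g‖ ^ 2) (stdGaussian E) := by
  have h : HasGaussianLaw (fun g => L g) (stdGaussian E) :=
    (IsGaussian.hasGaussianLaw_id (μ := stdGaussian E)).map L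
  exact h.memLp_two.integrable_norm_pow (by norm_num)

theorem integrable_norm_stdGaussian (L : E →L[ℝ] E) :
    Integrable (fun g => ‖L g‖) (stdGaussian E) := by
  have h : HasGaussianLaw (fun g => L g) (stdGaussian E) :=
    (IsGaussian.hasGaussianLaw_id (μ := stdGaussian E)).map L
  exact h.integrable.norm

theorem integral_norm_sq_starProjection (U : Submodule ℝ E) :
    ∫ g, ‖U.starProjection g‖ ^ 2 ∂stdGaussian E = Module.finrank ℝ U := by
  have h : ∀ g : E, ‖U.starProjection g‖ ^ 2 =
      ∑ i, (inner ℝ (stdOrthonormalBasis ℝ U i : E) g) ^ 2 := by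
    intro g
    have h1 : ‖U.starProjection g‖ = ‖U.orthogonalProjectionOnto g‖ := rfl
    rw [h1, ← (stdOrthonormalBasis ℝ U).sum_sq_inner_right]
    refine Finset.sum_congr rfl fun i _ => ?_
    rw [Submodule.inner_orthogonalProjectionOnto_eq_of_mem_left]
  simp_rw [h]
  rw [integral_finsetSum]
  · simp_rw [integral_inner_sq_stdGaussian]
    have : ∀ i, ‖(stdOrthonormalBasis ℝ U i : E)‖ = 1 := fun i =>
      (stdOrthonormalBasis ℝ U).orthonormal.1 i
    simp [this]
  · intro i _
    have h : HasGaussianLaw (fun g => innerSL ℝ (stdOrthonormalBasis ℝ U i : E) g) (stdGaussian E) :=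
      (IsGaussian.hasGaussianLaw_id (μ := stdGaussian E)).map _
    simpa using! h.memLp_two.integrable_sq

theorem lintegral_norm_le_of_sq {L : E →L[ℝ] E} {c : ℝ} (hc : 0 < c)
    (h : ∫ g, ‖L g‖ ^ 2 ∂stdGaussian E ≤ c ^ 2) :
    ∫⁻ g, ENNReal.ofReal ‖L g‖ ∂stdGaussian E ≤ ENNReal.ofReal c := by
  rw [← ofReal_integral_eq_lintegral_ofReal (integrable_norm_stdGaussian L)
    (ae_of_all _ fun _ => norm_nonneg _)]
  refine ENNReal.ofReal_le_ofReal ?_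
  have h1 : ∫ g, ‖L g‖ ∂stdGaussian E ≤ ∫ g, (‖L g‖ ^ 2 / (2 * c) + c / 2) ∂stdGaussian E := by
    refine integral_mono (integrable_norm_stdGaussian L)
      (((integrable_norm_sq_stdGaussian L).div_const _).add (integrable_const _)) fun g => ?_
    have : 0 ≤ (‖L g‖ - c) ^ 2 / (2 * c) := by positivity
    have e : (‖L g‖ - c) ^ 2 / (2 * c) = ‖L g‖ ^ 2 / (2 * c) + c / 2 - ‖L g‖ := by
      field_simp; ring
    simp only
    linarith
  refine h1.trans ?_
  rw [integral_add ((integrable_norm_sq_stdGaussian L).div_const _) (integrable_const _),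
    integral_div]
  have : (∫ g, ‖L g‖ ^ 2 ∂stdGaussian E) / (2 * c) ≤ c ^ 2 / (2 * c) := by gcongr
  have e : c ^ 2 / (2 * c) = c / 2 := by field_simp
  simp only [integral_const, probReal_univ, smul_eq_mul, one_mul]
  linarith

theorem lintegral_norm_stdGaussian_le {c : ℝ} (hc : 0 < c) (h : (Module.finrank ℝ E : ℝ) ≤ c ^ 2) :
    ∫⁻ g, ENNReal.ofReal ‖g‖ ∂stdGaussian E ≤ ENNReal.ofReal c := by
  have := lintegral_norm_le_of_sq (L := (⊤ : Submodule ℝ E).starProjection) hc (by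
    rw [integral_norm_sq_starProjection]; simpa using h)
  simpa [Submodule.starProjection_top] using this

/-- Small-ball estimate for a uniformly random unit vector of the subspace `U`. -/
theorem stdGaussian_abs_inner_normalize_le {U : Submodule ℝ E} {x : E} {k b τ : ℝ} (hk : 1 ≤ k)
    (hU : (Module.finrank ℝ U : ℝ) ≤ k) (hb : 0 < b) (hx : b ≤ ‖U.starProjection x‖) (hτ : 0 ≤ τ) :
    stdGaussian E {g | |inner ℝ (NormedSpace.normalize (U.starProjection g)) x| ≤ τ} ≤
      ENNReal.ofReal (2 * τ * √k / b) := by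
  have hsk : 1 ≤ √k := Real.one_le_sqrt.2 hk
  -- For 2τ > b the claimed bound is at least 1. The other case allows |e ⬝ g| to be absorbed below.
  rcases lt_or_ge b (2 * τ) with hlt | hle
  · refine prob_le_one.trans ?_
    rw [← ENNReal.ofReal_one]
    refine ENNReal.ofReal_le_ofReal ?_
    rw [le_div_iff₀ hb]
    nlinarith
  set x' := U.starProjection x with hx'
  have hn : 0 < ‖x'‖ := hb.trans_le hx
  obtain ⟨e, he_def⟩ : ∃ e, e = ‖x'‖⁻¹ • x' := ⟨_, rfl⟩
  have he : ‖e‖ = 1 := by rw [he_def, norm_smul, norm_inv, norm_norm, inv_mul_cancel₀ hn.ne']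
  have heU : e ∈ U := he_def ▸ U.smul_mem _ (U.starProjection_apply_mem x)
  -- The coefficient e ⬝ g and the rest L g of the projection to U are uncorrelated and jointly
  -- Gaussian, hence independent. The event forces |e ⬝ g| ≤ (2τ/b)‖L g‖; given L g this is a
  -- one-dimensional small-ball event, and the mean of ‖L g‖ is at most √k.
  let L : E →L[ℝ] E := U.starProjection - (innerSL ℝ e).smulRight e
  have hL : ∀ g, L g = U.starProjection g - inner ℝ e g • e := fun g => by simp [L]
  have heP : ∀ g, inner ℝ e (U.starProjection g) = inner ℝ e g := fun g => by
    rw [← U.inner_starProjection_left_eq_right, U.starProjection_eq_self_iff.2 heU]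
  have hLnorm : ∀ g, ‖L g‖ ^ 2 ≤ ‖U.starProjection g‖ ^ 2 := fun g => by
    rw [hL, norm_sub_sq_real, real_inner_smul_right, norm_smul, he, real_inner_comm e (U.starProjection g),
      heP, mul_one, Real.norm_eq_abs, sq_abs]
    nlinarith [sq_nonneg (inner ℝ e g)]
  have hind : IndepFun (fun g => inner ℝ e g) (fun g => L g) (stdGaussian E) := by
    have hgl : HasGaussianLaw (fun g => (inner ℝ e g, L g)) (stdGaussian E) :=
      (IsGaussian.hasGaussianLaw_id (μ := stdGaussian E)).map ((innerSL ℝ e).prod L)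
    refine hgl.indepFun_of_covariance_inner fun a y => ?_
    have h1 : ∀ g, inner ℝ a (inner ℝ e g) = inner ℝ (a • e) g := fun g => by
      rw [real_inner_smul_left]
      exact mul_comm _ _
    have h2 : ∀ g, inner ℝ y (L g) = inner ℝ (U.starProjection y - inner ℝ e y • e) g := fun g => by
      rw [hL, inner_sub_right, inner_sub_left, real_inner_smul_left, real_inner_smul_right,
        U.inner_starProjection_left_eq_right, real_inner_comm y e]
      ring
    simp_rw [h1, h2]
    rw [← covarianceBilin_apply_eq_cov IsGaussian.memLp_two_id, covarianceBilin_stdGaussian]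
    change inner ℝ (a • e) _ = 0
    rw [real_inner_smul_left, inner_sub_right, heP, real_inner_smul_right,
      real_inner_self_eq_norm_sq, he]
    ring
  have hmap := (indepFun_iff_map_prod_eq_prod_map_map (by fun_prop) (by fun_prop)).1 hind
  set c := 2 * τ / b with hc
  have hc0 : 0 ≤ c := by positivity
  have hms : MeasurableSet {p : ℝ × E | |p.1| ≤ c * ‖p.2‖} :=
    measurableSet_le (by fun_prop) (by fun_prop)
  have hsub : {g | |inner ℝ (NormedSpace.normalize (U.starProjection g)) x| ≤ τ} ⊆
      (fun g => (inner ℝ e g, L g)) ⁻¹' {p : ℝ × E | |p.1| ≤ c * ‖p.2‖} := by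
    intro g hg
    simp only [Set.mem_ofPred_eq, Set.mem_preimage] at hg ⊢
    have h1 : |inner ℝ (U.starProjection g) x| ≤ τ * ‖U.starProjection g‖ := by
      have := mul_le_mul_of_nonneg_right hg (norm_nonneg (U.starProjection g))
      rwa [← abs_norm (U.starProjection g), ← abs_mul, abs_norm, mul_comm (inner ℝ _ _),
        ← real_inner_smul_left, NormedSpace.norm_smul_normalize] at this
    have h2 : inner ℝ (U.starProjection g) x = ‖x'‖ * inner ℝ e g := by
      rw [he_def, real_inner_smul_left, ← mul_assoc, mul_inv_cancel₀ hn.ne', one_mul, hx',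
        U.inner_starProjection_left_eq_right, U.inner_starProjection_left_eq_right,
        ← U.inner_starProjection_left_eq_right, real_inner_comm]
    have h3 : ‖U.starProjection g‖ ≤ ‖L g‖ + |inner ℝ e g| := by
      have : U.starProjection g = L g + inner ℝ e g • e := by rw [hL]; abel
      calc ‖U.starProjection g‖ = ‖L g + inner ℝ e g • e‖ := by rw [← this]
        _ ≤ _ := norm_add_le _ _
        _ = _ := by rw [norm_smul, he, mul_one, Real.norm_eq_abs]
    rw [h2, abs_mul, abs_norm] at h1
    rw [hc, div_mul_eq_mul_div, le_div_iff₀ hb]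
    have h4 := mul_le_mul_of_nonneg_left h3 hτ
    have h5 := mul_le_mul_of_nonneg_right hx (abs_nonneg (inner ℝ e g))
    have h6 := mul_le_mul_of_nonneg_right hle (abs_nonneg (inner ℝ e g))
    nlinarith
  refine (measure_mono hsub).trans ?_
  rw [← Measure.map_apply (by fun_prop) hms, hmap, map_inner_stdGaussian he,
    Measure.prod_apply_symm hms, lintegral_map (measurable_measure_prodMk_right hms) (by fun_prop)]
  calc ∫⁻ g, gaussianReal 0 1 ((fun z => (z, L g)) ⁻¹' {p : ℝ × E | |p.1| ≤ c * ‖p.2‖})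
        ∂stdGaussian E
      ≤ ∫⁻ g, ENNReal.ofReal c * ENNReal.ofReal ‖L g‖ ∂stdGaussian E := by
        refine lintegral_mono fun g => ?_
        rw [← ENNReal.ofReal_mul hc0]
        exact gaussianReal_abs_le _
    _ = ENNReal.ofReal c * ∫⁻ g, ENNReal.ofReal ‖L g‖ ∂stdGaussian E :=
        lintegral_const_mul _ (by fun_prop)
    _ ≤ ENNReal.ofReal c * ENNReal.ofReal √k := by
        gcongr
        refine lintegral_norm_le_of_sq (by positivity) ?_
        rw [Real.sq_sqrt (by linarith)]
        refine le_trans ?_ hU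
        rw [← integral_norm_sq_starProjection]
        exact integral_mono (integrable_norm_sq_stdGaussian L)
          (integrable_norm_sq_stdGaussian _) hLnorm
    _ = ENNReal.ofReal (2 * τ * √k / b) := by
        rw [← ENNReal.ofReal_mul hc0, hc]
        congr 1
        ring

end Gaussian


/-! ### Projections and well-conditioned frames. -/

section Projection

variable {E : Type*} [NormedAddCommGroup E] [InnerProductSpace ℝ E] [FiniteDimensional ℝ E]

theorem exists_orthogonal_of_finrank_lt {L W : Submodule ℝ E} (hLW : L ≤ W)
    (h : Module.finrank ℝ L < Module.finrank ℝ W) : ∃ v ∈ W, v ∈ Lᗮ ∧ v ≠ 0 := by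
  have h1 := Submodule.finrank_add_inf_finrank_orthogonal hLW
  have h2 : Lᗮ ⊓ W ≠ ⊥ := by
    intro h0
    rw [h0, finrank_bot] at h1
    omega
  obtain ⟨v, hv, hv0⟩ := Submodule.exists_mem_ne_zero_of_ne_bot h2
  exact ⟨v, hv.2, hv.1, hv0⟩

/-- One Gram–Schmidt step, as a formula from which measurability in `a` and `v` can be read off. If
`a` projects to 0, division by zero returns 0 and nothing is subtracted, as it should be. -/
theorem starProjection_inf_orthogonal_singleton (U : Submodule ℝ E) (a v : E) :
    (U ⊓ (Submodule.span ℝ {a})ᗮ).starProjection v =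
      U.starProjection v -
        (inner ℝ (U.starProjection a) v / ‖U.starProjection a‖ ^ 2) • U.starProjection a := by
  set b := U.starProjection a with hb
  have hbU : b ∈ U := U.starProjection_apply_mem a
  have hbb : inner ℝ b a = ‖b‖ ^ 2 := by
    rw [← real_inner_self_eq_norm_sq, ← U.starProjection_eq_self_iff.2 hbU,
      U.inner_starProjection_left_eq_right, ← hb, U.starProjection_eq_self_iff.2 hbU]
  refine Submodule.eq_starProjection_of_mem_orthogonal' (z := v - U.starProjection v +
    (inner ℝ b v / ‖b‖ ^ 2) • b) ⟨?_, ?_⟩ ?_ (by abel)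
  · exact U.sub_mem (U.starProjection_apply_mem v) (U.smul_mem _ hbU)
  · rw [SetLike.mem_coe, Submodule.mem_orthogonal_singleton_iff_inner_left, inner_sub_left,
      real_inner_smul_left, hbb, U.inner_starProjection_left_eq_right, ← hb, real_inner_comm]
    rcases eq_or_ne b 0 with h0 | h0
    · simp [h0]
    · rw [div_mul_cancel₀ _ (by positivity), sub_self]
  · rw [Submodule.mem_orthogonal']
    rintro w ⟨hwU, hwa⟩
    rw [SetLike.mem_coe, Submodule.mem_orthogonal_singleton_iff_inner_left] at hwa
    have h1 : inner ℝ (v - U.starProjection v) w = 0 := by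
      rw [inner_sub_left, U.inner_starProjection_left_eq_right,
        U.starProjection_eq_self_iff.2 hwU, sub_self]
    have h2 : inner ℝ b w = 0 := by
      rw [hb, U.inner_starProjection_left_eq_right, U.starProjection_eq_self_iff.2 hwU,
        real_inner_comm, hwa]
    rw [inner_add_left, real_inner_smul_left, h1, h2, mul_zero, add_zero]

/-- `G` is a well-conditioned starting frame with respect to `W`. -/
def GoodStart {k : ℕ} (W : Submodule ℝ E) (η K : ℝ) (G : Fin k → E) : Prop :=
  (∀ (i : Fin k) (c : Fin k → ℝ), c i = 1 → η ≤ ‖W.starProjection (∑ j, c j • G j)‖) ∧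
    ∑ i, ‖G i‖ ≤ K

/-- By homogeneity the first condition bounds each coefficient: η|x i| is at most the norm of the
projection of ∑ x j G j. So coefficients map injectively, hence by dimension onto W, and K bounds
the norm of the preimage. -/
theorem GoodStart.exists_preimage {k : ℕ} {W : Submodule ℝ E} (hW : Module.finrank ℝ W = k)
    {η K : ℝ} (hη : 0 < η) {G : Fin k → E} (hG : GoodStart W η K G) {y : E} (hy : y ∈ W) :
    ∃ q ∈ Submodule.span ℝ (Set.range G), W.starProjection q = y ∧ ‖q‖ ≤ K / η * ‖y‖ := by
  have hlow : ∀ (x : Fin k → ℝ) i, η * |x i| ≤ ‖W.starProjection (∑ j, x j • G j)‖ := by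
    intro x i
    rcases eq_or_ne (x i) 0 with h0 | h0
    · simp [h0]
    have h1 := hG.1 i (fun j => (x i)⁻¹ * x j) (inv_mul_cancel₀ h0)
    simp_rw [mul_smul] at h1
    rw [← Finset.smul_sum, map_smul, norm_smul, norm_inv, Real.norm_eq_abs] at h1
    have := mul_le_mul_of_nonneg_right h1 (abs_nonneg (x i))
    rwa [mul_right_comm, inv_mul_cancel₀ (abs_ne_zero.2 h0), one_mul] at this
  let T : (Fin k → ℝ) →ₗ[ℝ] W :=
    W.orthogonalProjectionOnto.toLinearMap ∘ₗ Fintype.linearCombination ℝ G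
  have hT : ∀ x, ((T x : W) : E) = W.starProjection (∑ j, x j • G j) := fun x => by
    simp [T, Fintype.linearCombination_apply]
  have hinj : Function.Injective T := by
    rw [injective_iff_map_eq_zero]
    intro x hx
    funext i
    have h1 := hlow x i
    rw [← hT, hx, Submodule.coe_zero, norm_zero] at h1
    have h2 : |x i| ≤ 0 := by nlinarith [abs_nonneg (x i)]
    exact abs_nonpos_iff.1 h2
  have hsurj := (LinearMap.injective_iff_surjective_of_finrank_eq_finrank (by simp [hW])).1 hinj
  obtain ⟨x, hx⟩ := hsurj ⟨y, hy⟩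
  have hxy : W.starProjection (∑ j, x j • G j) = y := by rw [← hT, hx]
  refine ⟨∑ j, x j • G j, Submodule.sum_mem _ fun j _ => Submodule.smul_mem _ _
    (Submodule.subset_span ⟨j, rfl⟩), hxy, ?_⟩
  calc ‖∑ j, x j • G j‖ ≤ ∑ j, |x j| * ‖G j‖ := by
        refine (norm_sum_le _ _).trans_eq (Finset.sum_congr rfl fun j _ => ?_)
        rw [norm_smul, Real.norm_eq_abs]
    _ ≤ ∑ j, ‖y‖ / η * ‖G j‖ := by
        refine Finset.sum_le_sum fun j _ => mul_le_mul_of_nonneg_right ?_ (norm_nonneg _)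
        rw [le_div_iff₀ hη, mul_comm, ← hxy]
        exact hlow x j
    _ = ‖y‖ / η * ∑ j, ‖G j‖ := by rw [Finset.mul_sum]
    _ ≤ ‖y‖ / η * K := by gcongr; exact hG.2
    _ = K / η * ‖y‖ := by ring

end Projection

/-! ### Conditioning of a Gaussian matrix. -/

section GaussianMatrix

variable {E : Type*} [NormedAddCommGroup E] [InnerProductSpace ℝ E] [FiniteDimensional ℝ E]
  [MeasurableSpace E] [BorelSpace E]

/-- Fix the other k - 1 columns. Their projections cannot span W, so some nonzero v ∈ W is
orthogonal to them; pairing v with the combination gives v ⬝ G i whatever the other coefficients,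
and the one-dimensional small-ball bound applies. -/
theorem pi_stdGaussian_column_near_le {k : ℕ} {W : Submodule ℝ E} (hW : Module.finrank ℝ W = k)
    (η : ℝ) (i : Fin k) :
    (Measure.pi fun _ : Fin k => stdGaussian E)
      {G | ∃ c : Fin k → ℝ, c i = 1 ∧ ‖W.starProjection (∑ j, c j • G j)‖ < η} ≤
        ENNReal.ofReal η := by
  obtain ⟨k, rfl⟩ : ∃ l, k = l + 1 := ⟨k - 1, by have := i.pos; omega⟩
  set B := {G : Fin (k + 1) → E | ∃ c : Fin (k + 1) → ℝ, c i = 1 ∧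
    ‖W.starProjection (∑ j, c j • G j)‖ < η} with hB
  -- Openness gives the measurability needed for Fubini.
  have hopen : IsOpen B := by
    have : B = ⋃ c ∈ {c : Fin (k + 1) → ℝ | c i = 1},
        {G | ‖W.starProjection (∑ j, c j • G j)‖ < η} := by
      ext G; simp [B]
    rw [this]
    exact isOpen_biUnion fun c _ => isOpen_lt (by fun_prop) continuous_const
  have hmp := (measurePreserving_piFinSuccAbove (fun _ : Fin (k + 1) => stdGaussian E) i).symm
  have hmeas := hmp.measurable hopen.measurableSet
  rw [← hmp.measure_preimage hopen.measurableSet.nullMeasurableSet, Measure.prod_apply_symm hmeas]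
  refine (lintegral_mono (g := fun _ => ENNReal.ofReal η) fun G' => ?_).trans (by simp)
  set L := Submodule.span ℝ (Set.range fun j => W.starProjection (G' j)) with hL
  have hLW : L ≤ W := by
    rw [hL, Submodule.span_le]
    rintro _ ⟨j, rfl⟩
    exact W.starProjection_apply_mem _
  have hLk : Module.finrank ℝ L ≤ k := by
    have := finrank_range_le_card (R := ℝ) (fun j => W.starProjection (G' j))
    simpa using! this
  obtain ⟨v, hvW, hvL, hv0⟩ := exists_orthogonal_of_finrank_lt hLW (by omega)
  have hvn : 0 < ‖v‖ := norm_pos_iff.2 hv0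
  have hvG : ∀ j, inner ℝ v (G' j) = 0 := fun j => by
    have h1 : inner ℝ v (W.starProjection (G' j)) = 0 :=
      (Submodule.mem_orthogonal' L v).1 hvL _ (Submodule.subset_span ⟨j, rfl⟩)
    rwa [← W.inner_starProjection_left_eq_right, W.starProjection_eq_self_iff.2 hvW] at h1
  refine (measure_mono (t := {g | |inner ℝ v g| ≤ ‖v‖ * η}) ?_).trans
    ((stdGaussian_abs_inner_le hv0 _).trans_eq (by rw [mul_div_cancel_left₀ _ hvn.ne']))
  rintro g ⟨c, hc, hlt⟩
  simp only [Set.mem_ofPred_eq]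
  have hsum : inner ℝ v (W.starProjection (∑ j, c j • (i.insertNth g G' : Fin (k + 1) → E) j)) =
      inner ℝ v g := by
    rw [← W.inner_starProjection_left_eq_right, W.starProjection_eq_self_iff.2 hvW,
      Fin.sum_univ_succAbove _ i]
    simp [hc, inner_add_right, inner_sum, real_inner_smul_right, hvG]
  rw [← hsum]
  refine (abs_real_inner_le_norm _ _).trans ?_
  gcongr
  exact hlt.le

theorem pi_stdGaussian_sum_norm_gt_le {k : ℕ} {K D : ℝ} (hK : 0 < K) (hD : 0 < D)
    (hE : (Module.finrank ℝ E : ℝ) ≤ D ^ 2) :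
    (Measure.pi fun _ : Fin k => stdGaussian E) {G | K < ∑ i, ‖G i‖} ≤
      ENNReal.ofReal (k * D / K) := by
  have h1 : ∫⁻ G, ∑ i, ENNReal.ofReal ‖G i‖ ∂(Measure.pi fun _ : Fin k => stdGaussian E) ≤
      ENNReal.ofReal (k * D) := by
    rw [lintegral_finsetSum _ (by fun_prop)]
    have h2 : ∀ i : Fin k, ∫⁻ G, ENNReal.ofReal ‖G i‖
        ∂(Measure.pi fun _ : Fin k => stdGaussian E) ≤ ENNReal.ofReal D := fun i => by
      have := (measurePreserving_eval (fun _ : Fin k => stdGaussian E) i).lintegral_comp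
        (f := fun g => ENNReal.ofReal ‖g‖) (by fun_prop)
      exact this.trans_le (lintegral_norm_stdGaussian_le hD hE)
    refine (Finset.sum_le_sum fun i _ => h2 i).trans_eq ?_
    rw [Finset.sum_const, Finset.card_univ, Fintype.card_fin, nsmul_eq_mul,
      ENNReal.ofReal_mul (by positivity), ENNReal.ofReal_natCast]
  have h3 := meas_ge_le_lintegral_div (μ := Measure.pi fun _ : Fin k => stdGaussian E)
    (f := fun G => ∑ i, ENNReal.ofReal ‖G i‖)
    (Measurable.aemeasurable (by fun_prop)) (ε := ENNReal.ofReal K)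
    (by simpa using hK) (by simp)
  rw [ENNReal.ofReal_div_of_pos hK]
  refine (measure_mono fun G hG => ?_).trans (h3.trans (ENNReal.div_le_div_right h1 _))
  simp only [Set.mem_ofPred_eq] at hG ⊢
  rw [← ENNReal.ofReal_sum_of_nonneg fun i _ => norm_nonneg _]
  exact ENNReal.ofReal_le_ofReal hG.le

theorem pi_stdGaussian_not_goodStart_le {k : ℕ} {W : Submodule ℝ E}
    (hW : Module.finrank ℝ W = k) {η K D : ℝ} (hη : 0 ≤ η) (hK : 0 < K) (hD : 0 < D)
    (hE : (Module.finrank ℝ E : ℝ) ≤ D ^ 2) :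
    (Measure.pi fun _ : Fin k => stdGaussian E) {G | ¬ GoodStart W η K G} ≤
      ENNReal.ofReal (k * η + k * D / K) := by
  rw [ENNReal.ofReal_add (by positivity) (by positivity)]
  have hsub : {G : Fin k → E | ¬ GoodStart W η K G} ⊆
      (⋃ i, {G | ∃ c : Fin k → ℝ, c i = 1 ∧ ‖W.starProjection (∑ j, c j • G j)‖ < η}) ∪
        {G | K < ∑ i, ‖G i‖} := by
    intro G hG
    simp only [GoodStart, Set.mem_ofPred_eq, not_and_or, not_forall, not_le] at hG
    rcases hG with ⟨i, c, hc, h⟩ | h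
    · exact Or.inl (Set.mem_iUnion.2 ⟨i, c, hc, h⟩)
    · exact Or.inr h
  refine (measure_mono hsub).trans ((measure_union_le _ _).trans (add_le_add ?_
    (pi_stdGaussian_sum_norm_gt_le hK hD hE)))
  refine (measure_iUnion_fintype_le _ _).trans
    ((Finset.sum_le_sum fun i _ => pi_stdGaussian_column_near_le hW η i).trans_eq ?_)
  rw [Finset.sum_const, Finset.card_univ, Fintype.card_fin, nsmul_eq_mul,
    ENNReal.ofReal_mul (by positivity), ENNReal.ofReal_natCast]

end GaussianMatrix

/-! ### Measurable families of subspaces. -/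

section Measurability

variable {E : Type*} [NormedAddCommGroup E] [InnerProductSpace ℝ E] [FiniteDimensional ℝ E]
  [MeasurableSpace E] [BorelSpace E] {X : Type*} [MeasurableSpace X]

/-- A family of subspaces whose orthogonal projections depend measurably on the parameter. -/
def MeasurableProj (U : X → Submodule ℝ E) : Prop :=
  ∀ v : X → E, Measurable v → Measurable fun x => (U x).starProjection (v x)

theorem measurableProj_const (U : Submodule ℝ E) : MeasurableProj fun _ : X => U :=
  fun _ hv => U.starProjection.measurable.comp hv

theorem MeasurableProj.orthogonal {U : X → Submodule ℝ E} (hU : MeasurableProj U) :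
    MeasurableProj fun x => (U x)ᗮ := by
  intro v hv
  simp_rw [Submodule.starProjection_orthogonal_val]
  exact hv.sub (hU v hv)

theorem MeasurableProj.inf_orthogonal_singleton {U : X → Submodule ℝ E} (hU : MeasurableProj U)
    {a : X → E} (ha : Measurable a) :
    MeasurableProj fun x => U x ⊓ (Submodule.span ℝ {a x})ᗮ := by
  intro v hv
  simp_rw [starProjection_inf_orthogonal_singleton]
  have h1 := hU a ha
  exact (hU v hv).sub ((((h1.inner hv)).div (h1.norm.pow_const 2)).smul h1)

theorem MeasurableProj.inf_orthogonal_span_image {ι : Type*} {U : X → Submodule ℝ E}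
    (hU : MeasurableProj U) {a : ι → X → E} (ha : ∀ i, Measurable (a i)) (s : Finset ι) :
    MeasurableProj fun x => U x ⊓ (Submodule.span ℝ ((fun i => a i x) '' s))ᗮ := by
  classical
  induction s using Finset.induction_on with
  | empty => simpa using hU
  | insert i s hi ih =>
    have h := ih.inf_orthogonal_singleton (ha i)
    convert h using 2 with x
    rw [Finset.coe_insert, Set.image_insert_eq, Submodule.span_insert,
      ← Submodule.inf_orthogonal, inf_assoc, inf_comm (Submodule.span ℝ {a i x})ᗮ]

/-- The orthogonal complement of the span arises from the whole space by successive Gram–Schmidt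
steps, each of them measurable even where the dimension jumps. -/
theorem measurableProj_span_range {ι : Type*} [Fintype ι] {a : ι → X → E}
    (ha : ∀ i, Measurable (a i)) :
    MeasurableProj fun x => Submodule.span ℝ (Set.range fun i => a i x) := by
  have h := ((measurableProj_const (X := X) (⊤ : Submodule ℝ E)).inf_orthogonal_span_image ha
    Finset.univ).orthogonal
  simpa [Submodule.orthogonal_orthogonal] using h

end Measurability

/-! ### Existence and measurability of runs. -/

section Run

variable {d n k : ℕ}

/-- Orthonormalization preserves spans, so it can be dropped from the iteration. Both the
convergence estimate and measurability in G use this form. -/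
theorem span_powerIter (A : Fin n → Pt d) (G : Fin k → Pt d) (t : ℕ) :
    Submodule.span ℝ (Set.range (powerIter A G t)) =
      Submodule.span ℝ (Set.range fun i =>
        ((colMap A).comp (ContinuousLinearMap.adjoint (colMap A)) ^ t) (G i)) := by
  induction t with
  | zero =>
    rw [powerIter, InnerProductSpace.span_gramSchmidtNormed_range,
      InnerProductSpace.span_gramSchmidt]
    rfl
  | succ t ih =>
    set F := (colMap A).comp (ContinuousLinearMap.adjoint (colMap A)) with hF
    rw [powerIter, InnerProductSpace.span_gramSchmidtNormed_range,
      InnerProductSpace.span_gramSchmidt]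
    have h1 : Set.range (fun ℓ => (colMap A)
        ((ContinuousLinearMap.adjoint (colMap A)) (powerIter A G t ℓ))) =
        (F : Pt d →ₗ[ℝ] Pt d) '' Set.range (powerIter A G t) := by
      rw [← Set.range_comp]; rfl
    have h2 : Set.range (fun i => (F ^ (t + 1)) (G i)) =
        (F : Pt d →ₗ[ℝ] Pt d) '' Set.range (fun i => (F ^ t) (G i)) := by
      rw [← Set.range_comp, pow_succ']; rfl
    rw [h1, h2, ← Submodule.map_span, ← Submodule.map_span, ih]

theorem measurableProj_roundSpace (A : Fin n → Pt d) (t : ℕ) (R : Fin k → Finset (Fin n))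
    (r : Fin k) :
    MeasurableProj fun ω : (Fin k → Pt d) × (Fin k → Pt d) => roundSpace A t ω.1 R r := by
  have h1 : MeasurableProj fun ω : (Fin k → Pt d) × (Fin k → Pt d) =>
      Submodule.span ℝ (Set.range (powerIter A ω.1 t)) := by
    simp_rw [span_powerIter]
    exact measurableProj_span_range fun i => by fun_prop
  have h2 := h1.inf_orthogonal_span_image (a := fun s _ => avg A (R s)) (fun _ => measurable_const)
    (Finset.univ.filter fun s => s < r)
  simpa [roundSpace] using! h2

theorem measurable_roundDir (A : Fin n → Pt d) (t : ℕ) (R : Fin k → Finset (Fin n)) (r : Fin k) :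
    Measurable fun ω : (Fin k → Pt d) × (Fin k → Pt d) => roundDir A t ω.1 ω.2 R r := by
  have h := measurableProj_roundSpace A t R r (fun ω => ω.2 r) (by fun_prop)
  exact (h.norm.inv).smul h

theorem measurableSet_isRun (A : Fin n → Pt d) (m t : ℕ) (R : Fin k → Finset (Fin n)) :
    MeasurableSet {ω | IsRun A m t ω R} := by
  simp only [IsRun]
  refine MeasurableSet.congr (s := ⋂ r, ({_ω | (R r).card = m} ∩ ⋂ S, ({_ω | S.card ≠ m} ∪
    {ω : (Fin k → Pt d) × (Fin k → Pt d) | |inner ℝ (roundDir A t ω.1 ω.2 R r) (avg A S)| ≤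
      |inner ℝ (roundDir A t ω.1 ω.2 R r) (avg A (R r))|}))) ?_ ?_
  · refine MeasurableSet.iInter fun r => (MeasurableSet.const _).inter
      (MeasurableSet.iInter fun S => (MeasurableSet.const _).union ?_)
    have h := measurable_roundDir A t R r
    exact measurableSet_le (h.inner measurable_const).abs (h.inner measurable_const).abs
  · ext ω
    simp [imp_iff_not_or]

theorem exists_isRun (A : Fin n → Pt d) {m : ℕ} (t : ℕ) (hm : m ≤ n)
    (ω : (Fin k → Pt d) × (Fin k → Pt d)) : ∃ R, IsRun A m t ω R := by
  classical
  have key : ∀ j : ℕ, ∃ R : Fin k → Finset (Fin n), ∀ r : Fin k, r.1 < j → (R r).card = m ∧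
      ∀ S : Finset (Fin n), S.card = m →
        |inner ℝ (roundDir A t ω.1 ω.2 R r) (avg A S)| ≤
          |inner ℝ (roundDir A t ω.1 ω.2 R r) (avg A (R r))| := by
    intro j
    induction j with
    | zero => exact ⟨fun _ => ∅, fun r hr => absurd hr (Nat.not_lt_zero _)⟩
    | succ j ih =>
      obtain ⟨R, hR⟩ := ih
      by_cases hj : j < k
      · obtain ⟨S₀, hS₀⟩ : (Finset.univ.filter fun S : Finset (Fin n) => S.card = m).Nonempty := by
          obtain ⟨S, -, hS⟩ := Finset.exists_subset_card_eq (s := (Finset.univ : Finset (Fin n)))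
            (n := m) (by simpa using hm)
          exact ⟨S, by simpa using hS⟩
        obtain ⟨T, hT, hmax⟩ := Finset.exists_max_image _
          (fun S => |inner ℝ (roundDir A t ω.1 ω.2 R ⟨j, hj⟩) (avg A S)|) ⟨S₀, hS₀⟩
        -- The subspace of round r involves only the choices before r, so filling in round j leaves
        -- the directions up to round j unchanged.
        have hdir : ∀ r : Fin k, r.1 ≤ j →
            roundDir A t ω.1 ω.2 (Function.update R ⟨j, hj⟩ T) r = roundDir A t ω.1 ω.2 R r := by
          intro r hr
          have : (fun s => avg A (Function.update R ⟨j, hj⟩ T s)) '' {s | s < r} =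
              (fun s => avg A (R s)) '' {s | s < r} := by
            refine Set.image_congr fun s hs => ?_
            have : s ≠ ⟨j, hj⟩ := by
              rintro rfl
              exact absurd (Fin.lt_def.1 hs) (by simpa using hr)
            rw [Function.update_of_ne this]
          have hsp : roundSpace A t ω.1 (Function.update R ⟨j, hj⟩ T) r =
              roundSpace A t ω.1 R r := by
            unfold roundSpace
            rw [this]
          simp only [roundDir, hsp]
        refine ⟨Function.update R ⟨j, hj⟩ T, fun r hr => ?_⟩
        rw [hdir r (by omega)]
        rcases eq_or_ne r ⟨j, hj⟩ with rfl | hne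
        · rw [Function.update_self]
          simp only [Finset.mem_filter, Finset.mem_univ, true_and] at hT hmax
          exact ⟨hT, fun S hS => hmax S hS⟩
        · rw [Function.update_of_ne hne]
          refine hR r ?_
          have : r.1 ≠ j := fun h => hne (Fin.ext h)
          omega
      · exact ⟨R, fun r _ => hR r (by have := r.2; omega)⟩
  obtain ⟨R, hR⟩ := key k
  exact ⟨R, fun r => hR r r.2⟩

theorem measurableSet_not_recovers (A : Fin n → Pt d) {m : ℕ} (t : ℕ) (hm : m ≤ n)
    (M : Fin k → Pt d) (ε : ℝ) : MeasurableSet {ω | ¬ Recovers A m t M ε ω} := by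
  have : {ω | ¬ Recovers A m t M ε ω} = ⋃ R, ({ω | IsRun A m t ω R} ∩
      {_ω | ¬ ∃ π : Equiv.Perm (Fin k), ∀ ℓ, ‖avg A (R ℓ) - M (π ℓ)‖ ≤ ε}) := by
    ext ω
    simp only [Recovers, Set.mem_ofPred_eq, exists_isRun A t hm ω, true_and, not_forall,
      Set.mem_iUnion, Set.mem_inter_iff]
    simp
  rw [this]
  exact MeasurableSet.iUnion fun R => (measurableSet_isRun A m t R).inter (MeasurableSet.const _)

end Run


/-! ### Convergence of the subspace power method. -/

section PowerMethod

variable {E : Type*} [NormedAddCommGroup E] [InnerProductSpace ℝ E]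
  {ι : Type*} [Fintype ι]

theorem finrank_span_image_orthonormalBasis (b : OrthonormalBasis ι ℝ E) (I : Finset ι) :
    Module.finrank ℝ (Submodule.span ℝ (b '' I)) = I.card := by
  have h : LinearIndependent ℝ fun i : I => b i :=
    b.orthonormal.linearIndependent.comp _ Subtype.val_injective
  have := finrank_span_eq_card h
  rw [Fintype.card_coe] at this
  rw [← this, Set.image_eq_range]
  rfl

theorem inner_eq_zero_of_mem_span_image (b : OrthonormalBasis ι ℝ E) {I : Finset ι} {x : E}
    (hx : x ∈ Submodule.span ℝ (b '' I)) {i : ι} (hi : i ∉ I) : inner ℝ (b i) x = 0 := by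
  have h : Submodule.span ℝ (b '' I) ≤ (Submodule.span ℝ {b i})ᗮ := by
    rw [Submodule.span_le]
    rintro _ ⟨j, hj, rfl⟩
    rw [SetLike.mem_coe, Submodule.mem_orthogonal_singleton_iff_inner_right]
    exact b.orthonormal.2 fun h => hi (h ▸ hj)
  exact (Submodule.mem_orthogonal_singleton_iff_inner_right).1 (h hx)

theorem inner_eq_zero_of_mem_span_image_orthogonal (b : OrthonormalBasis ι ℝ E) {I : Finset ι}
    {x : E} (hx : x ∈ (Submodule.span ℝ (b '' I))ᗮ) {i : ι} (hi : i ∈ I) :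
    inner ℝ (b i) x = 0 :=
  (Submodule.mem_orthogonal _ _).1 hx _ (Submodule.subset_span ⟨i, hi, rfl⟩)

theorem inner_pow_apply_eigenbasis (b : OrthonormalBasis ι ℝ E) {ev : ι → ℝ} {F : E →L[ℝ] E}
    (hF : ∀ x i, inner ℝ (b i) (F x) = ev i * inner ℝ (b i) x) (t : ℕ) (x : E) (i : ι) :
    inner ℝ (b i) ((F ^ t) x) = ev i ^ t * inner ℝ (b i) x := by
  induction t with
  | zero => simp
  | succ t ih =>
    rw [pow_succ', mul_apply_eq_comp, hF, ih, pow_succ']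
    ring

theorem norm_pow_apply_le (b : OrthonormalBasis ι ℝ E) {ev : ι → ℝ} {F : E →L[ℝ] E}
    (hF : ∀ x i, inner ℝ (b i) (F x) = ev i * inner ℝ (b i) x) {μ : ℝ} (hμ : 0 ≤ μ)
    (h0 : ∀ i, 0 ≤ ev i) {x : E} (h : ∀ i, inner ℝ (b i) x ≠ 0 → ev i ≤ μ) (t : ℕ) :
    ‖(F ^ t) x‖ ≤ μ ^ t * ‖x‖ := by
  refine le_of_sq_le_sq ?_ (by positivity)
  rw [mul_pow, ← b.sum_sq_inner_right, ← b.sum_sq_inner_right, Finset.mul_sum]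
  refine Finset.sum_le_sum fun i _ => ?_
  rw [inner_pow_apply_eigenbasis b hF, mul_pow]
  by_cases hi : inner ℝ (b i) x = 0
  · simp [hi]
  · have := h0 i
    have := h i hi
    gcongr

theorem le_norm_pow_apply (b : OrthonormalBasis ι ℝ E) {ev : ι → ℝ} {F : E →L[ℝ] E}
    (hF : ∀ x i, inner ℝ (b i) (F x) = ev i * inner ℝ (b i) x) {μ : ℝ} (hμ : 0 ≤ μ)
    {x : E} (h : ∀ i, inner ℝ (b i) x ≠ 0 → μ ≤ ev i) (t : ℕ) :
    μ ^ t * ‖x‖ ≤ ‖(F ^ t) x‖ := by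
  refine le_of_sq_le_sq ?_ (norm_nonneg _)
  rw [mul_pow, ← b.sum_sq_inner_right, ← b.sum_sq_inner_right, Finset.mul_sum]
  refine Finset.sum_le_sum fun i _ => ?_
  rw [inner_pow_apply_eigenbasis b hF, mul_pow]
  by_cases hi : inner ℝ (b i) x = 0
  · simp [hi]
  · have := h i hi
    gcongr

variable [FiniteDimensional ℝ E] {H : Type*} [NormedAddCommGroup H] [InnerProductSpace ℝ H] [CompleteSpace H]

/-- A min–max argument by counting dimensions. T is disjoint from the span of the eigenvectors of
BBᵀ with eigenvalue below s², and Tᗮ from that with eigenvalue above ε². So at least dim T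
eigenvalues are ≥ s² and at most dim T are > ε²: the two sets agree, and W is spanned by their
eigenvectors. -/
theorem exists_top_subspace (B : H →L[ℝ] E) (T : Submodule ℝ E) {ε s : ℝ}
    (hε : 0 ≤ ε) (hεs : ε < s)
    (hT : ∀ x ∈ T, s * ‖x‖ ≤ ‖ContinuousLinearMap.adjoint B x‖)
    (hT' : ∀ x ∈ Tᗮ, ‖ContinuousLinearMap.adjoint B x‖ ≤ ε * ‖x‖) :
    ∃ W : Submodule ℝ E, Module.finrank ℝ W = Module.finrank ℝ T ∧
      (∀ x ∈ Wᗮ, ‖ContinuousLinearMap.adjoint B x‖ ≤ ε * ‖x‖) ∧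
      ∀ (t : ℕ), (∀ x ∈ Wᗮ, ‖((B.comp (ContinuousLinearMap.adjoint B)) ^ t) x‖ ≤ (ε ^ 2) ^ t * ‖x‖) ∧
        ∀ w ∈ W, ∃ y ∈ W, ((B.comp (ContinuousLinearMap.adjoint B)) ^ t) y = w ∧
          (s ^ 2) ^ t * ‖y‖ ≤ ‖w‖ := by
  classical
  have hs : 0 < s := hε.trans_lt hεs
  set F := B.comp (ContinuousLinearMap.adjoint B) with hFdef
  have hsymm : (F : E →ₗ[ℝ] E).IsSymmetric := fun x y => by
    change inner ℝ (B (ContinuousLinearMap.adjoint B x)) y =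
      inner ℝ x (B (ContinuousLinearMap.adjoint B y))
    rw [← ContinuousLinearMap.adjoint_inner_right]
    exact ContinuousLinearMap.adjoint_inner_left B _ _
  set b := hsymm.eigenvectorBasis rfl with hb
  set ev := hsymm.eigenvalues rfl with hev
  have hF : ∀ x i, inner ℝ (b i) (F x) = ev i * inner ℝ (b i) x := fun x i => by
    have h1 := hsymm (b i) x
    have h2 := hsymm.apply_eigenvectorBasis rfl i
    rw [h2] at h1
    change _ = inner ℝ (b i) (F x) at h1
    rw [← h1]
    exact real_inner_smul_left _ _ _
  have hq : ∀ x, ‖ContinuousLinearMap.adjoint B x‖ ^ 2 = ∑ i, ev i * (inner ℝ (b i) x) ^ 2 := by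
    intro x
    have h1 : ‖ContinuousLinearMap.adjoint B x‖ ^ 2 = inner ℝ x (F x) := by
      rw [← real_inner_self_eq_norm_sq, ContinuousLinearMap.adjoint_inner_left]
      rfl
    rw [h1, ← b.sum_inner_mul_inner]
    refine Finset.sum_congr rfl fun i _ => ?_
    rw [hF, real_inner_comm]
    ring
  have h0 : ∀ i, 0 ≤ ev i := fun i => by
    have h1 := hq (b i)
    rw [Finset.sum_eq_single i] at h1
    · rw [b.inner_eq_one, one_pow, mul_one] at h1
      rw [← h1]
      positivity
    · intro j _ hji
      rw [b.inner_eq_zero hji]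
      simp
    · simp
  set I := Finset.univ.filter fun i => s ^ 2 ≤ ev i with hI
  set J := Finset.univ.filter fun i => ε ^ 2 < ev i with hJ
  have hεs2 : ε ^ 2 < s ^ 2 := by gcongr
  have hIJ : I ⊆ J := fun i hi => by
    simp only [I, J, Finset.mem_filter, Finset.mem_univ, true_and] at hi ⊢
    linarith
  have hTE := T.finrank_add_finrank_orthogonal
  have hcardJ : J.card ≤ Module.finrank ℝ T := by
    have hd : Disjoint (Submodule.span ℝ (b '' J)) Tᗮ := by
      rw [Submodule.disjoint_def]
      intro x hxJ hxT
      by_contra hx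
      obtain ⟨j, hj⟩ : ∃ j, inner ℝ (b j) x ≠ 0 := by
        by_contra! h
        have := b.sum_sq_inner_right x
        simp only [h] at this
        exact hx (by simpa using this.symm)
      have h1 : (ε * ‖x‖) ^ 2 < ‖ContinuousLinearMap.adjoint B x‖ ^ 2 := by
        rw [mul_pow, ← b.sum_sq_inner_right, hq, Finset.mul_sum]
        have hmem : ∀ i, inner ℝ (b i) x ≠ 0 → ε ^ 2 < ev i := fun i hi => by
          by_contra hni
          exact hi (inner_eq_zero_of_mem_span_image b hxJ (by simpa [J] using hni))
        refine Finset.sum_lt_sum (fun i _ => ?_) ⟨j, Finset.mem_univ _, ?_⟩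
        · by_cases hi : inner ℝ (b i) x = 0
          · simp [hi]
          · have := hmem i hi
            gcongr
        · have := hmem j hj
          gcongr
      exact absurd (pow_le_pow_left₀ (norm_nonneg _) (hT' x hxT) 2) (not_le.2 h1)
    have := Submodule.finrank_add_finrank_le_of_disjoint hd
    rw [finrank_span_image_orthonormalBasis] at this
    omega
  have hWE := (Submodule.span ℝ (b '' I)).finrank_add_finrank_orthogonal
  rw [finrank_span_image_orthonormalBasis] at hWE
  have hcardI : Module.finrank ℝ T ≤ I.card := by
    have hd : Disjoint T (Submodule.span ℝ (b '' I))ᗮ := by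
      rw [Submodule.disjoint_def]
      intro x hxT hxI
      by_contra hx
      obtain ⟨j, hj⟩ : ∃ j, inner ℝ (b j) x ≠ 0 := by
        by_contra! h
        have := b.sum_sq_inner_right x
        simp only [h] at this
        exact hx (by simpa using this.symm)
      have h1 : ‖ContinuousLinearMap.adjoint B x‖ ^ 2 < (s * ‖x‖) ^ 2 := by
        rw [mul_pow, ← b.sum_sq_inner_right, hq, Finset.mul_sum]
        have hmem : ∀ i, inner ℝ (b i) x ≠ 0 → ev i < s ^ 2 := fun i hi => by
          by_contra hni
          exact hi (inner_eq_zero_of_mem_span_image_orthogonal b hxI (by simpa [I] using hni))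
        refine Finset.sum_lt_sum (fun i _ => ?_) ⟨j, Finset.mem_univ _, ?_⟩
        · by_cases hi : inner ℝ (b i) x = 0
          · simp [hi]
          · have := hmem i hi
            gcongr
        · have := hmem j hj
          gcongr
      exact absurd (pow_le_pow_left₀ (by positivity) (hT x hxT) 2) (not_le.2 h1)
    have := Submodule.finrank_add_finrank_le_of_disjoint hd
    omega
  have hIJeq : I = J := Finset.eq_of_subset_of_card_le hIJ (hcardJ.trans hcardI)
  have hperp : ∀ x ∈ (Submodule.span ℝ (b '' I))ᗮ, ∀ i, inner ℝ (b i) x ≠ 0 → ev i ≤ ε ^ 2 := by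
    intro x hx i hi
    by_contra! hni
    refine hi (inner_eq_zero_of_mem_span_image_orthogonal b hx ?_)
    rw [hIJeq]
    simpa [J] using hni
  refine ⟨Submodule.span ℝ (b '' I), ?_, fun x hx => ?_, fun t => ⟨fun x hx => ?_, fun w hw => ?_⟩⟩
  · rw [finrank_span_image_orthonormalBasis]
    exact le_antisymm ((Finset.card_le_card hIJ).trans hcardJ) hcardI
  · refine le_of_sq_le_sq ?_ (by positivity)
    rw [mul_pow, hq, ← b.sum_sq_inner_right, Finset.mul_sum]
    refine Finset.sum_le_sum fun i _ => ?_
    by_cases hi : inner ℝ (b i) x = 0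
    · simp [hi]
    · have := hperp x hx i hi
      gcongr
  · exact norm_pow_apply_le b hF (by positivity) h0 (hperp x hx) t
  -- On W the map is diagonal with eigenvalues at least s² > 0, so its power is inverted
  -- coordinatewise.
  · have hy : ∑ i ∈ I, ((ev i ^ t)⁻¹ * inner ℝ (b i) w) • b i ∈ Submodule.span ℝ (b '' I) :=
      Submodule.sum_mem _ fun i hi => Submodule.smul_mem _ _ (Submodule.subset_span ⟨i, hi, rfl⟩)
    have hFy : (F ^ t) (∑ i ∈ I, ((ev i ^ t)⁻¹ * inner ℝ (b i) w) • b i) = w := by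
      refine b.repr.injective ?_
      ext j
      rw [b.repr_apply_apply, b.repr_apply_apply, inner_pow_apply_eigenbasis b hF]
      by_cases hj : j ∈ I
      · rw [b.orthonormal.inner_right_sum _ hj]
        have : ev j ≠ 0 := by
          simp only [I, Finset.mem_filter, Finset.mem_univ, true_and] at hj
          have : 0 < s ^ 2 := by positivity
          linarith
        field_simp
      · rw [inner_eq_zero_of_mem_span_image b hy hj, inner_eq_zero_of_mem_span_image b hw hj,
          mul_zero]
    refine ⟨_, hy, hFy, ?_⟩
    conv_rhs => rw [← hFy]
    refine le_norm_pow_apply b hF (by positivity) (fun i hi => ?_) t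
    by_contra hni
    exact hi (inner_eq_zero_of_mem_span_image b hy (by simpa [I] using hni))

/-- The subspace power method started from a well-conditioned frame captures the subspace `T`. -/
theorem exists_good_start_subspace (B : H →L[ℝ] E) (T : Submodule ℝ E) {ε s : ℝ}
    (hε : 0 ≤ ε) (hεs : ε < s)
    (hT : ∀ x ∈ T, s * ‖x‖ ≤ ‖ContinuousLinearMap.adjoint B x‖)
    (hT' : ∀ x ∈ Tᗮ, ‖ContinuousLinearMap.adjoint B x‖ ≤ ε * ‖x‖) :
    ∃ W : Submodule ℝ E, Module.finrank ℝ W = Module.finrank ℝ T ∧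
      ∀ {k : ℕ} (_ : Module.finrank ℝ T = k) (η K : ℝ) (_ : 0 < η) (_ : 0 ≤ K) (G : Fin k → E)
        (_ : GoodStart W η K G) (t : ℕ), ∀ e ∈ T, ∃ v ∈ Submodule.span ℝ
          (Set.range fun i => ((B.comp (ContinuousLinearMap.adjoint B)) ^ t) (G i)),
          ‖e - v‖ ≤ (2 * (ε / s) + (ε / s) ^ (2 * t) * (K / η)) * ‖e‖ := by
  have hs : 0 < s := hε.trans_lt hεs
  obtain ⟨W, hW, hW1, hW2⟩ := exists_top_subspace B T hε hεs hT hT'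
  refine ⟨W, hW, fun {k} hk η K hη hK G hG t e he => ?_⟩
  set F := B.comp (ContinuousLinearMap.adjoint B) with hFdef
  set x := e - W.starProjection e with hx
  have hxW : x ∈ Wᗮ := W.sub_starProjection_mem_orthogonal e
  -- The adjoint is at most ε on Wᗮ and on Tᗮ and at least s on T, so the T-component of x is at
  -- most (2ε/s)‖x‖. As e ∈ T, ‖x‖² = e ⬝ x sees only this component.
  have hx1 : ‖x‖ ≤ 2 * (ε / s) * ‖e‖ := by
    have h1 : s * ‖T.starProjection x‖ ≤ 2 * ε * ‖x‖ := by
      have h2 := hT _ (T.starProjection_apply_mem x)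
      have h3 := hT' _ (T.sub_starProjection_mem_orthogonal x)
      have h4 := hW1 x hxW
      have h5 : ContinuousLinearMap.adjoint B (T.starProjection x) =
          ContinuousLinearMap.adjoint B x -
            ContinuousLinearMap.adjoint B (x - T.starProjection x) := by
        rw [← map_sub, sub_sub_cancel]
      have h6 : ‖x - T.starProjection x‖ ≤ ‖x‖ := by
        rw [← Submodule.starProjection_orthogonal_val]
        exact Submodule.norm_starProjection_apply_le _ _
      rw [h5] at h2
      have h7 := h2.trans (norm_sub_le _ _)
      nlinarith [mul_le_mul_of_nonneg_left h6 hε]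
    have h2 : ‖x‖ ^ 2 ≤ ‖e‖ * ‖T.starProjection x‖ := by
      have h3 : ‖x‖ ^ 2 = inner ℝ e x := by
        rw [← real_inner_self_eq_norm_sq]
        conv_lhs => rw [hx, inner_sub_left, ← hx]
        rw [(Submodule.mem_orthogonal _ _).1 hxW _ (W.starProjection_apply_mem e), sub_zero]
      rw [h3, ← T.starProjection_eq_self_iff.2 he, T.inner_starProjection_left_eq_right,
        T.starProjection_eq_self_iff.2 he]
      exact real_inner_le_norm _ _
    rcases eq_or_lt_of_le (norm_nonneg x) with h0 | h0
    · rw [← h0]; positivity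
    · have h3 : s * ‖x‖ ≤ 2 * ε * ‖e‖ := by
        have : ‖x‖ * (s * ‖x‖) ≤ ‖x‖ * (2 * ε * ‖e‖) := by
          nlinarith [mul_le_mul_of_nonneg_left h1 (norm_nonneg e),
            mul_le_mul_of_nonneg_left h2 hs.le]
        exact le_of_mul_le_mul_left this h0
      rw [show 2 * (ε / s) * ‖e‖ = 2 * ε * ‖e‖ / s by ring, le_div_iff₀ hs]
      linarith
  -- Choose q in the span of the start so that F^t q has the same W-component as e. The Wᗮ-part of q
  -- is multiplied by at most ε^(2t), whereas y has norm at most ‖e‖/s^(2t).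
  obtain ⟨y, hyW, hFy, hyn⟩ := (hW2 t).2 _ (W.starProjection_apply_mem e)
  obtain ⟨q, hqG, hqy, hqn⟩ := hG.exists_preimage (hW.trans hk) hη hyW
  refine ⟨(F ^ t) q, ?_, ?_⟩
  · have : Set.range (fun i => (F ^ t) (G i)) =
        ((F ^ t : E →L[ℝ] E) : E →ₗ[ℝ] E) '' Set.range G := by
      rw [← Set.range_comp]; rfl
    rw [this, ← Submodule.map_span]
    exact ⟨q, hqG, rfl⟩
  · have h1 : e - (F ^ t) q = x - (F ^ t) (q - W.starProjection q) := by
      rw [map_sub, hqy, hFy, hx]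
      abel
    have h2 := (hW2 t).1 _ (W.sub_starProjection_mem_orthogonal q)
    have h3 : ‖q - W.starProjection q‖ ≤ ‖q‖ := by
      rw [← Submodule.starProjection_orthogonal_val]
      exact Submodule.norm_starProjection_apply_le _ _
    have h4 : ‖y‖ ≤ ‖e‖ / (s ^ 2) ^ t := by
      rw [le_div_iff₀ (by positivity), mul_comm]
      exact hyn.trans (Submodule.norm_starProjection_apply_le _ _)
    rw [h1, add_mul]
    refine (norm_sub_le _ _).trans (add_le_add hx1 (h2.trans ?_))
    calc (ε ^ 2) ^ t * ‖q - W.starProjection q‖ ≤ (ε ^ 2) ^ t * (K / η * (‖e‖ / (s ^ 2) ^ t)) := by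
          gcongr
          exact h3.trans (hqn.trans (by gcongr))
      _ = (ε / s) ^ (2 * t) * (K / η) * ‖e‖ := by
          rw [div_pow, pow_mul, pow_mul]
          ring

end PowerMethod


/-- Vectors of U see x only through its projection to U. Hence tied choices lead to the same next
subspace. -/
theorem inf_orthogonal_eq_of_starProjection_eq {E : Type*} [NormedAddCommGroup E]
    [InnerProductSpace ℝ E] {U : Submodule ℝ E} [U.HasOrthogonalProjection]
    {x y : E} (h : U.starProjection x = U.starProjection y ∨
      U.starProjection x = -U.starProjection y) :
    U ⊓ (Submodule.span ℝ {x})ᗮ = U ⊓ (Submodule.span ℝ {y})ᗮ := by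
  ext u
  simp only [Submodule.mem_inf, Submodule.mem_orthogonal_singleton_iff_inner_left]
  refine and_congr_right fun hu => ?_
  have hz : ∀ z, inner ℝ u z = inner ℝ u (U.starProjection z) := fun z => by
    rw [← U.inner_starProjection_left_eq_right, U.starProjection_eq_self_iff.2 hu]
  rw [hz x, hz y]
  rcases h with h | h <;> simp [h]

/-! ### Induction over the rounds, with arbitrary tie-breaking. -/

section Rounds

variable {E : Type*} [NormedAddCommGroup E] [InnerProductSpace ℝ E] [FiniteDimensional ℝ E]
  {n k : ℕ}

/-- `S` is a possible choice of a round with subspace `U` and Gaussian vector `g`. -/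
def IsChoice (a : Finset (Fin n) → E) (m : ℕ) (U : Submodule ℝ E) (g : E)
    (S : Finset (Fin n)) : Prop :=
  S.card = m ∧ ∀ S' : Finset (Fin n), S'.card = m →
    |inner ℝ (NormedSpace.normalize (U.starProjection g)) (a S')| ≤
      |inner ℝ (NormedSpace.normalize (U.starProjection g)) (a S)|

/-- `R` is a possible sequence of choices when the rounds start from the subspace `U`. -/
def IsRunFrom (a : Finset (Fin n) → E) (m : ℕ) (U : Submodule ℝ E) {j : ℕ} (g : Fin j → E)
    (R : Fin j → Finset (Fin n)) : Prop :=
  ∀ r, IsChoice a m (U ⊓ (Submodule.span ℝ ((fun s => a (R s)) '' {s | s < r}))ᗮ) (g r) (R r)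

/-- The random bits for which some run from `U` does not recover new centers outside `F`. -/
def failSet (a : Finset (Fin n) → E) (m : ℕ) (M : Fin k → E) (ε : ℝ) (U : Submodule ℝ E)
    (F : Finset (Fin k)) (j : ℕ) : Set (Fin j → E) :=
  {g | ∃ R, IsRunFrom a m U g R ∧ ¬ ∃ f : Fin j → Fin k, Function.Injective f ∧
    (∀ r, f r ∉ F) ∧ ∀ r, ‖a (R r) - M (f r)‖ ≤ ε}

theorem IsRunFrom.head {a : Finset (Fin n) → E} {m : ℕ} {U : Submodule ℝ E} {j : ℕ}
    {g : Fin (j + 1) → E} {R : Fin (j + 1) → Finset (Fin n)} (h : IsRunFrom a m U g R) :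
    IsChoice a m U (g 0) (R 0) := by
  have h0 := h 0
  have : {s : Fin (j + 1) | s < 0} = ∅ := by ext; simp
  simpa [IsChoice, this] using h0

theorem IsRunFrom.tail {a : Finset (Fin n) → E} {m : ℕ} {U : Submodule ℝ E} {j : ℕ}
    {g : Fin (j + 1) → E} {R : Fin (j + 1) → Finset (Fin n)} (h : IsRunFrom a m U g R) :
    IsRunFrom a m (U ⊓ (Submodule.span ℝ {a (R 0)})ᗮ) (Fin.tail g) (Fin.tail R) := by
  intro r
  have h1 := h r.succ
  have h2 : (fun s => a (R s)) '' {s | s < r.succ} =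
      insert (a (R 0)) ((fun s => a (Fin.tail R s)) '' {s | s < r}) := by
    ext x
    simp only [Set.mem_image, Set.mem_ofPred_eq, Set.mem_insert_iff, Fin.exists_fin_succ,
      Fin.succ_lt_succ_iff, Fin.tail, Fin.succ_pos, true_and]
    simp [eq_comm]
  have h3 : U ⊓ (Submodule.span ℝ ((fun s => a (R s)) '' {s | s < r.succ}))ᗮ =
      U ⊓ (Submodule.span ℝ {a (R 0)})ᗮ ⊓
        (Submodule.span ℝ ((fun s => a (Fin.tail R s)) '' {s | s < r}))ᗮ := by
    rw [h2, Submodule.span_insert, ← Submodule.inf_orthogonal, inf_assoc]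
  simpa only [h3] using! h1

theorem tail_mem_failSet {a : Finset (Fin n) → E} {m : ℕ} {M : Fin k → E} {ε : ℝ}
    {U U' : Submodule ℝ E} {F : Finset (Fin k)} {j : ℕ} {g : Fin (j + 1) → E} {ℓ : Fin k}
    {R : Fin (j + 1) → Finset (Fin n)} (hR : IsRunFrom a m U g R)
    (hfail : ¬ ∃ f : Fin (j + 1) → Fin k, Function.Injective f ∧ (∀ r, f r ∉ F) ∧
      ∀ r, ‖a (R r) - M (f r)‖ ≤ ε)
    (hℓ : ℓ ∉ F) (hnear : ‖a (R 0) - M ℓ‖ ≤ ε)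
    (hU' : U' = U ⊓ (Submodule.span ℝ {a (R 0)})ᗮ) :
    Fin.tail g ∈ failSet a m M ε U' (insert ℓ F) j := by
  subst hU'
  refine ⟨Fin.tail R, hR.tail, ?_⟩
  rintro ⟨f, hf, hfF, hfn⟩
  refine hfail ⟨Fin.cons ℓ f, ?_, ?_, ?_⟩
  · rw [Fin.cons_injective_iff]
    refine ⟨?_, hf⟩
    rintro ⟨r, hr⟩
    exact hfF r (by simp [hr])
  · refine Fin.cases (by simpa using hℓ) fun r => ?_
    have := hfF r
    simp only [Finset.mem_insert, not_or] at this
    simpa using this.2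
  · exact Fin.cases (by simpa using hnear) fun r => by simpa [Fin.tail] using hfn r

variable [MeasurableSpace E] [BorelSpace E]

/-- Almost surely, choices that tie have the same projection to `U` up to sign. -/
theorem stdGaussian_tie_eq_zero (U : Submodule ℝ E) {x y : E}
    (h : ¬ (U.starProjection x = U.starProjection y ∨ U.starProjection x = -U.starProjection y)) :
    stdGaussian E {g | |inner ℝ (NormedSpace.normalize (U.starProjection g)) x| =
      |inner ℝ (NormedSpace.normalize (U.starProjection g)) y|} = 0 := by
  rw [not_or] at h
  -- A tie puts g in the hyperplane orthogonal to the projection of x - y or of x + y, and both are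
  -- null sets.
  have h1 : U.starProjection (x - y) ≠ 0 := by rw [map_sub, sub_ne_zero]; exact h.1
  have h2 : U.starProjection (x + y) ≠ 0 := by
    rw [map_add]
    exact fun h0 => h.2 (eq_neg_of_add_eq_zero_left h0)
  have hnull : ∀ z : E, z ≠ 0 → stdGaussian E {g | |inner ℝ z g| ≤ 0} = 0 := fun z hz => by
    simpa using stdGaussian_abs_inner_le hz 0
  refine measure_mono_null ?_ (measure_union_null (hnull _ h1) (hnull _ h2))
  intro g hg
  simp only [Set.mem_ofPred_eq, Set.mem_union] at hg ⊢
  have h3 : ∀ z, ‖U.starProjection g‖ * inner ℝ (NormedSpace.normalize (U.starProjection g)) z =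
      inner ℝ g (U.starProjection z) := fun z => by
    rw [← real_inner_smul_left, NormedSpace.norm_smul_normalize,
      U.inner_starProjection_left_eq_right]
  rw [map_sub, map_add, inner_sub_left, inner_add_left, real_inner_comm, ← h3,
    real_inner_comm _ (U.starProjection y), ← h3, ← mul_sub, ← mul_add]
  rcases abs_eq_abs.1 hg with h | h
  · left; simp [h]
  · right; simp [h]

theorem measurableSet_isChoice (a : Finset (Fin n) → E) (m : ℕ) (U : Submodule ℝ E)
    (S : Finset (Fin n)) : MeasurableSet {g | IsChoice a m U g S} := by
  have hdir : Measurable fun g : E => NormedSpace.normalize (U.starProjection g) :=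
    (U.starProjection.measurable.norm.inv).smul U.starProjection.measurable
  refine MeasurableSet.congr (s := {_g | S.card = m} ∩ ⋂ S' : Finset (Fin n), ({_g | S'.card ≠ m} ∪
    {g : E | |inner ℝ (NormedSpace.normalize (U.starProjection g)) (a S')| ≤
      |inner ℝ (NormedSpace.normalize (U.starProjection g)) (a S)|})) ?_ ?_
  · exact (MeasurableSet.const _).inter (MeasurableSet.iInter fun S' =>
      (MeasurableSet.const _).union (measurableSet_le (hdir.inner measurable_const).abs
        (hdir.inner measurable_const).abs))
  · ext g
    simp [IsChoice, imp_iff_not_or]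

/-- If every round recovers a new center with failure probability at most `p`, whatever happened
before, then `j` rounds fail with probability at most `j * p`. Ties do no harm, since tied choices
almost surely leave the same subspace for the next round. -/
theorem pi_stdGaussian_failSet_le {a : Finset (Fin n) → E} {m : ℕ} {M : Fin k → E} {ε : ℝ}
    {p : ENNReal} (Inv : Submodule ℝ E → Finset (Fin k) → Prop)
    (hInv : ∀ U F ℓ S, Inv U F → ℓ ∉ F → ‖a S - M ℓ‖ ≤ ε →
      Inv (U ⊓ (Submodule.span ℝ {a S})ᗮ) (insert ℓ F))
    (huniq : ∀ x ℓ ℓ', ‖x - M ℓ‖ ≤ ε → ‖x - M ℓ'‖ ≤ ε → ℓ = ℓ')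
    (hp : ∀ U F, Inv U F → F ≠ Finset.univ →
      stdGaussian E {g | ¬ ∃ ℓ ∉ F, ∀ S, IsChoice a m U g S → ‖a S - M ℓ‖ ≤ ε} ≤ p) :
    ∀ (j : ℕ) (U : Submodule ℝ E) (F : Finset (Fin k)), Inv U F → F.card + j ≤ k →
      (Measure.pi fun _ : Fin j => stdGaussian E) (failSet a m M ε U F j) ≤ j * p := by
  classical
  intro j
  induction j with
  | zero =>
    intro U F _ _
    have : failSet a m M ε U F 0 = ∅ := by
      ext g
      simp only [failSet, Set.mem_ofPred_eq, Set.mem_empty_iff_false, iff_false]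
      rintro ⟨R, -, h⟩
      exact h ⟨fun r => r.elim0, fun r => r.elim0, fun r => r.elim0, fun r => r.elim0⟩
    simp [this]
  | succ j ih =>
    intro U F hUF hcard
    have hF : F ≠ Finset.univ := by
      rintro rfl
      simp at hcard
    set bad := {g | ¬ ∃ ℓ ∉ F, ∀ S, IsChoice a m U g S → ‖a S - M ℓ‖ ≤ ε} with hbad
    set tie := ⋃ q : Finset (Fin n) × Finset (Fin n), {g : E |
      ¬ (U.starProjection (a q.1) = U.starProjection (a q.2) ∨
        U.starProjection (a q.1) = -U.starProjection (a q.2)) ∧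
      |inner ℝ (NormedSpace.normalize (U.starProjection g)) (a q.1)| =
        |inner ℝ (NormedSpace.normalize (U.starProjection g)) (a q.2)|} with htie
    have htie0 : stdGaussian E tie = 0 := by
      refine measure_iUnion_null fun q => ?_
      by_cases hq : U.starProjection (a q.1) = U.starProjection (a q.2) ∨
        U.starProjection (a q.1) = -U.starProjection (a q.2)
      · simp [hq]
      · exact measure_mono_null (fun g hg => hg.2) (stdGaussian_tie_eq_zero U hq)
    -- In an arbitrary enumeration, D S is the event that S is the first possible choice. These
    -- events are disjoint and measurable, so their probabilities sum to at most 1.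
    let ord := Fintype.equivFin (Finset (Fin n))
    let D : Finset (Fin n) → Set E := fun S =>
      {g | IsChoice a m U g S} ∩ ⋂ S', ({g | IsChoice a m U g S'}ᶜ ∪ {_g | ord S ≤ ord S'})
    have hD : ∀ S, MeasurableSet (D S) := fun S =>
      (measurableSet_isChoice a m U S).inter (MeasurableSet.iInter fun S' =>
        (measurableSet_isChoice a m U S').compl.union (MeasurableSet.const _))
    have hDle : ∀ {S S' g}, g ∈ D S → IsChoice a m U g S' → ord S ≤ ord S' := by
      intro S S' g hg hS'
      have := Set.mem_iInter.1 hg.2 S'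
      simpa [hS'] using this
    have hDdisj : Pairwise (Function.onFun Disjoint D) := by
      intro S S' hne
      refine Set.disjoint_left.2 fun g hg hg' => hne ?_
      exact ord.injective (le_antisymm (hDle hg hg'.1) (hDle hg' hg.1))
    have hDsum : ∑ S, stdGaussian E (D S) ≤ 1 := by
      rw [← tsum_fintype (L := SummationFilter.unconditional _), ← measure_iUnion hDdisj hD]
      exact prob_le_one
    -- Failure in the remaining rounds if S is chosen now. It depends on the first Gaussian vector
    -- only through S, which makes the cover a union of rectangles.
    let N : Finset (Fin n) → Set (Fin j → E) := fun S =>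
      if h : ∃ ℓ ∉ F, ‖a S - M ℓ‖ ≤ ε then
        failSet a m M ε (U ⊓ (Submodule.span ℝ {a S})ᗮ) (insert h.choose F) j else ∅
    have hN : ∀ S, (Measure.pi fun _ : Fin j => stdGaussian E) (N S) ≤ j * p := by
      intro S
      by_cases h : ∃ ℓ ∉ F, ‖a S - M ℓ‖ ≤ ε
      · simp only [N, dif_pos h]
        refine ih _ _ (hInv U F _ S hUF h.choose_spec.1 h.choose_spec.2) ?_
        rw [Finset.card_insert_of_notMem h.choose_spec.1]
        omega
      · simp [N, dif_neg h]
    have hmp := measurePreserving_piFinSuccAbove (fun _ : Fin (j + 1) => stdGaussian E) 0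
    have hsub : failSet a m M ε U F (j + 1) ⊆
        (MeasurableEquiv.piFinSuccAbove (fun _ : Fin (j + 1) => E) 0) ⁻¹'
          (((tie ∪ bad) ×ˢ Set.univ) ∪ ⋃ S, D S ×ˢ N S) := by
      rintro g ⟨R, hR, hfail⟩
      have hval : (MeasurableEquiv.piFinSuccAbove (fun _ : Fin (j + 1) => E) 0) g =
          (g 0, Fin.tail g) := rfl
      rw [Set.mem_preimage, hval]
      by_cases htb : g 0 ∈ tie ∪ bad
      · exact Or.inl ⟨htb, Set.mem_univ _⟩
      right
      rw [Set.mem_union, not_or] at htb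
      obtain ⟨ℓ, hℓF, hℓ⟩ := not_not.1 htb.2
      have hhead := hR.head
      obtain ⟨S, hS, hSmin⟩ := Finset.exists_min_image
        (Finset.univ.filter fun S => IsChoice a m U (g 0) S) ord ⟨R 0, by simpa using hhead⟩
      simp only [Finset.mem_filter, Finset.mem_univ, true_and] at hS hSmin
      have hDS : g 0 ∈ D S := by
        refine ⟨hS, Set.mem_iInter.2 fun S' => ?_⟩
        by_cases h : IsChoice a m U (g 0) S'
        · exact Or.inr (hSmin S' h)
        · exact Or.inl h
      refine Set.mem_iUnion.2 ⟨S, hDS, ?_⟩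
      have hex : ∃ ℓ ∉ F, ‖a S - M ℓ‖ ≤ ε := ⟨ℓ, hℓF, hℓ S hS⟩
      have hch : hex.choose = ℓ := huniq _ _ _ hex.choose_spec.2 (hℓ S hS)
      simp only [N, dif_pos hex, hch]
      refine tail_mem_failSet hR hfail hℓF (hℓ _ hhead) ?_
      -- R 0 ties with the first choice S, so outside the null event their projections to U agree up
      -- to sign.
      refine inf_orthogonal_eq_of_starProjection_eq ?_
      by_contra hne
      refine htb.1 (Set.mem_iUnion.2 ⟨(S, R 0), hne, ?_⟩)
      exact le_antisymm (hhead.2 S hS.1) (hS.2 (R 0) hhead.1)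
    calc (Measure.pi fun _ : Fin (j + 1) => stdGaussian E) (failSet a m M ε U F (j + 1))
        ≤ ((stdGaussian E).prod (Measure.pi fun _ : Fin j => stdGaussian E))
          (((tie ∪ bad) ×ˢ Set.univ) ∪ ⋃ S, D S ×ˢ N S) := by
          refine (measure_mono hsub).trans_eq ?_
          exact hmp.measure_preimage_equiv _
      _ ≤ p + ∑ S, stdGaussian E (D S) * (j * p) := by
          refine (measure_union_le _ _).trans (add_le_add ?_ ?_)
          -- The product formula holds for arbitrary sets, so neither `bad` nor `N S` has to be
          -- measurable.
          · rw [Measure.prod_prod, measure_univ, mul_one]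
            refine (measure_union_le _ _).trans ?_
            rw [htie0, zero_add]
            exact hp U F hUF hF
          · refine (measure_iUnion_fintype_le _ _).trans (Finset.sum_le_sum fun S _ => ?_)
            rw [Measure.prod_prod]
            gcongr
            exact hN S
      _ ≤ p + 1 * (j * p) := by
          rw [← Finset.sum_mul]
          gcongr
      _ = ((j + 1 : ℕ) : ENNReal) * p := by
          push_cast
          ring

end Rounds


/-! ### Maximizing averages lie near a vertex. -/

section Selection

variable {E : Type*} [NormedAddCommGroup E] [InnerProductSpace ℝ E] {n k : ℕ}

theorem abs_add_lt_abs_of_lt {x y τ : ℝ} (h : |y| ≤ |x|) (h1 : τ < |x - y|) (h2 : τ < |x + y|) :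
    |y| + τ < |x| := by
  rcases abs_cases x with ⟨hx, _⟩ | ⟨hx, _⟩ <;> rcases abs_cases y with ⟨hy, _⟩ | ⟨hy, _⟩ <;>
    rcases abs_cases (x - y) with ⟨h3, _⟩ | ⟨h3, _⟩ <;>
    rcases abs_cases (x + y) with ⟨h4, _⟩ | ⟨h4, _⟩ <;> linarith

/-- If the values `|u ⬝ M ℓ|` of the centers outside `F` are separated from all the others, then
the maximizing averages are all close to one center outside `F`. -/
theorem exists_center_near_maximizers {a : Finset (Fin n) → E} {m : ℕ} {M : Fin k → E} {u : E}
    {s τ μ ε : ℝ} {F : Finset (Fin k)} (hk : 2 ≤ k) (hτ : 0 < τ) (hM : ∀ ℓ, ‖M ℓ‖ ≤ μ)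
    (hu : ‖u‖ ≤ 1)
    (hnear : ∀ ℓ, ∃ S, S.card = m ∧ ‖a S - M ℓ‖ ≤ 5 * s)
    (hconv : ∀ S, S.card = m → ∃ w : Fin k → ℝ, (∀ ℓ, 0 ≤ w ℓ) ∧ ∑ ℓ, w ℓ = 1 ∧
      ‖a S - ∑ ℓ, w ℓ • M ℓ‖ ≤ s)
    (hF : F ≠ Finset.univ) (hfound : ∀ i ∈ F, |inner ℝ u (M i)| ≤ τ)
    (hgap : ∀ ℓ ∉ F, ∀ ℓ', ℓ' ≠ ℓ → ∀ c : SignType, τ < |inner ℝ u (M ℓ + (c : ℝ) • M ℓ')|)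
    (hε : 12 * s * μ / τ + s ≤ ε) :
    ∃ ℓ ∉ F, ∀ S, S.card = m → (∀ S', S'.card = m → |inner ℝ u (a S')| ≤ |inner ℝ u (a S)|) →
      ‖a S - M ℓ‖ ≤ ε := by
  have hu' : ∀ x, |inner ℝ u x| ≤ ‖x‖ := fun x =>
    (abs_real_inner_le_norm u x).trans (mul_le_of_le_one_left (norm_nonneg x) hu)
  have : Nontrivial (Fin k) := Fin.nontrivial_iff_two_le.2 hk
  obtain ⟨ℓ₀, hℓ₀⟩ : ∃ ℓ, ℓ ∉ F := by
    by_contra! h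
    exact hF (Finset.eq_univ_iff_forall.2 h)
  obtain ⟨ℓ, -, hmax⟩ := Finset.exists_max_image Finset.univ (fun ℓ => |inner ℝ u (M ℓ)|)
    ⟨ℓ₀, Finset.mem_univ _⟩
  -- The sign 0 makes centers outside F exceed τ, while those in F do not. The signs ±1 then give
  -- the separation by τ.
  have hℓF : ℓ ∉ F := by
    intro h
    obtain ⟨ℓ', hℓ'⟩ := exists_ne ℓ₀
    have h1 := hgap ℓ₀ hℓ₀ ℓ' hℓ' 0
    simp only [SignType.coe_zero, zero_smul, add_zero] at h1
    linarith [hfound ℓ h, hmax ℓ₀ (Finset.mem_univ _)]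
  have hsep : ∀ ℓ', ℓ' ≠ ℓ → |inner ℝ u (M ℓ')| + τ < |inner ℝ u (M ℓ)| := by
    intro ℓ' hne
    have h1 := hgap ℓ hℓF ℓ' hne 1
    have h2 := hgap ℓ hℓF ℓ' hne (-1)
    simp only [SignType.coe_one, SignType.coe_neg_one, one_smul, neg_smul, inner_add_right,
      ← sub_eq_add_neg, inner_sub_right] at h1 h2
    exact abs_add_lt_abs_of_lt (hmax ℓ' (Finset.mem_univ _)) h2 h1
  refine ⟨ℓ, hℓF, fun S hS hSmax => ?_⟩
  obtain ⟨w, hw0, hw1, hwS⟩ := hconv S hS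
  obtain ⟨S₀, hS₀, hS₀n⟩ := hnear ℓ
  -- ∑ w i * q i is the weight off ℓ. Each unit of it costs τ in |u ⬝ a S|, while maximality allows
  -- a loss of 5s + s only; so it is at most 6s/τ, and it moves the point by at most 2μ per unit.
  let q : Fin k → ℝ := fun i => if i = ℓ then 0 else 1
  have hlow : |inner ℝ u (M ℓ)| - 5 * s ≤ |inner ℝ u (a S)| := by
    have h1 := hu' (a S₀ - M ℓ)
    rw [inner_sub_right] at h1
    have h2 := abs_sub_abs_le_abs_sub (inner ℝ u (M ℓ)) (inner ℝ u (a S₀))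
    rw [abs_sub_comm] at h2
    linarith [hSmax S₀ hS₀]
  have hup : |inner ℝ u (a S)| ≤ |inner ℝ u (M ℓ)| - τ * ∑ i, w i * q i + s := by
    have h1 := hu' (a S - ∑ i, w i • M i)
    rw [inner_sub_right] at h1
    have h2 := abs_sub_abs_le_abs_sub (inner ℝ u (a S)) (inner ℝ u (∑ i, w i • M i))
    have h3 : |inner ℝ u (∑ i, w i • M i)| ≤ ∑ i, w i * (|inner ℝ u (M ℓ)| - τ * q i) := by
      rw [inner_sum]
      refine (Finset.abs_sum_le_sum_abs _ _).trans (Finset.sum_le_sum fun i _ => ?_)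
      rw [real_inner_smul_right, abs_mul, abs_of_nonneg (hw0 i)]
      refine mul_le_mul_of_nonneg_left ?_ (hw0 i)
      by_cases hi : i = ℓ
      · simp [q, hi]
      · have := hsep i hi
        simp only [q, if_neg hi]
        linarith
    have h4 : ∑ i, w i * (|inner ℝ u (M ℓ)| - τ * q i) =
        |inner ℝ u (M ℓ)| - τ * ∑ i, w i * q i := by
      simp_rw [mul_sub, Finset.sum_sub_distrib, ← Finset.sum_mul, hw1, Finset.mul_sum]
      rw [one_mul]
      congr 1
      exact Finset.sum_congr rfl fun i _ => by ring
    linarith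
  have hwq : ∑ i, w i * q i ≤ 6 * s / τ := by
    rw [le_div_iff₀ hτ]
    linarith
  have hdist : ‖∑ i, w i • M i - M ℓ‖ ≤ (∑ i, w i * q i) * (2 * μ) := by
    have h1 : ∑ i, w i • M i - M ℓ = ∑ i, w i • (M i - M ℓ) := by
      simp_rw [smul_sub, Finset.sum_sub_distrib, ← Finset.sum_smul, hw1, one_smul]
    rw [h1, Finset.sum_mul]
    refine (norm_sum_le _ _).trans (Finset.sum_le_sum fun i _ => ?_)
    rw [norm_smul, Real.norm_of_nonneg (hw0 i), mul_assoc]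
    refine mul_le_mul_of_nonneg_left ?_ (hw0 i)
    by_cases hi : i = ℓ
    · simp [q, hi]
    · simp only [q, if_neg hi]
      linarith [norm_sub_le (M i) (M ℓ), hM i, hM ℓ]
  have hμ : 0 ≤ μ := (norm_nonneg _).trans (hM ℓ)
  calc ‖a S - M ℓ‖ = ‖(∑ i, w i • M i - M ℓ) + (a S - ∑ i, w i • M i)‖ := by congr 1; abel
    _ ≤ (∑ i, w i * q i) * (2 * μ) + s := (norm_add_le _ _).trans (add_le_add hdist hwS)
    _ ≤ 6 * s / τ * (2 * μ) + s := by gcongr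
    _ = 12 * s * μ / τ + s := by ring
    _ ≤ ε := hε

end Selection

/-! ### Dual vectors of the centers. -/

section Dual

variable {E : Type*} [NormedAddCommGroup E] [InnerProductSpace ℝ E] {k : ℕ}

/-- `e` is a family of unit vectors in the span of the centers, with `e ℓ` orthogonal to all
centers but `M ℓ`, and `e ℓ ⬝ M ℓ ≥ β`. -/
structure IsDualFamily (M : Fin k → E) (β : ℝ) (e : Fin k → E) : Prop where
  norm_eq_one : ∀ ℓ, ‖e ℓ‖ = 1
  mem_span : ∀ ℓ, e ℓ ∈ Submodule.span ℝ (Set.range M)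
  inner_eq_zero : ∀ ℓ ℓ', ℓ' ≠ ℓ → inner ℝ (e ℓ) (M ℓ') = 0
  le_inner : ∀ ℓ, β ≤ inner ℝ (e ℓ) (M ℓ)

/-- e ℓ is the normalized component of M ℓ orthogonal to the other centers, so that e ℓ ⬝ M ℓ is the
length of this component. -/
theorem WellSeparated.exists_isDualFamily {d : ℕ} {M : Fin k → Pt d} {α : ℝ}
    (h : WellSeparated M α) (ℓ₀ : Fin k) (hpos : 0 < α * ‖M ℓ₀‖) :
    ∃ e, IsDualFamily M (α * ‖M ℓ₀‖) e := by
  let L : Fin k → Submodule ℝ (Pt d) := fun ℓ => Submodule.span ℝ (M '' {i | i ≠ ℓ})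
  let b : Fin k → Pt d := fun ℓ => (L ℓ)ᗮ.starProjection (M ℓ)
  have hb : ∀ ℓ, α * ‖M ℓ₀‖ ≤ ‖b ℓ‖ := fun ℓ => h ℓ ℓ₀
  have hb0 : ∀ ℓ, 0 < ‖b ℓ‖ := fun ℓ => hpos.trans_le (hb ℓ)
  have hbL : ∀ ℓ, b ℓ ∈ (L ℓ)ᗮ := fun ℓ => Submodule.starProjection_apply_mem _ _
  refine ⟨fun ℓ => ‖b ℓ‖⁻¹ • b ℓ, ⟨fun ℓ => ?_, fun ℓ => ?_, fun ℓ ℓ' hne => ?_, fun ℓ => ?_⟩⟩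
  · rw [norm_smul, norm_inv, norm_norm, inv_mul_cancel₀ (hb0 ℓ).ne']
  · refine Submodule.smul_mem _ _ ?_
    have : b ℓ = M ℓ - (L ℓ).starProjection (M ℓ) := Submodule.starProjection_orthogonal_val _
    rw [this]
    refine Submodule.sub_mem _ (Submodule.subset_span ⟨ℓ, rfl⟩) ?_
    exact Submodule.span_mono (Set.image_subset_range _ _) (Submodule.starProjection_apply_mem _ _)
  · rw [real_inner_smul_left, (Submodule.mem_orthogonal' _ _).1 (hbL ℓ) _
      (Submodule.subset_span ⟨ℓ', hne, rfl⟩), mul_zero]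
  · have h1 : inner ℝ (b ℓ) (M ℓ) = ‖b ℓ‖ ^ 2 := by
      calc inner ℝ (b ℓ) (M ℓ) = inner ℝ ((L ℓ)ᗮ.starProjection (b ℓ)) (M ℓ) := by
            rw [Submodule.starProjection_eq_self_iff.2 (hbL ℓ)]
        _ = inner ℝ (b ℓ) (b ℓ) := Submodule.inner_starProjection_left_eq_right _ _ _
        _ = ‖b ℓ‖ ^ 2 := real_inner_self_eq_norm_sq _
    rw [real_inner_smul_left, h1, pow_two, ← mul_assoc, inv_mul_cancel₀ (hb0 ℓ).ne', one_mul]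
    exact hb ℓ

namespace IsDualFamily

variable {M e : Fin k → E} {β : ℝ}

theorem inner_sum_smul (h : IsDualFamily M β e) (c : Fin k → ℝ) (ℓ : Fin k) :
    inner ℝ (e ℓ) (∑ i, c i • M i) = c ℓ * inner ℝ (e ℓ) (M ℓ) := by
  rw [inner_sum, Finset.sum_eq_single ℓ, real_inner_smul_right]
  · intro i _ hi
    rw [real_inner_smul_right, h.inner_eq_zero ℓ i hi, mul_zero]
  · simp

theorem linearIndependent (h : IsDualFamily M β e) (hβ : 0 < β) : LinearIndependent ℝ M := by
  rw [Fintype.linearIndependent_iff]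
  intro c hc i
  have h1 := h.inner_sum_smul c i
  rw [hc, inner_zero_right] at h1
  have h2 := h.le_inner i
  exact (mul_eq_zero.1 h1.symm).resolve_right (by linarith)

/-- If x = ∑ c ℓ M ℓ, pairing with e ℓ gives β|c ℓ| ≤ ‖x‖, while ‖x‖² = ∑ c ℓ (M ℓ ⬝ x). This is the
source of the lower singular value bound on the span of the centers. -/
theorem le_sum_abs_inner (h : IsDualFamily M β e) (hβ : 0 < β) {x : E}
    (hx : x ∈ Submodule.span ℝ (Set.range M)) : β * ‖x‖ ≤ ∑ ℓ, |inner ℝ (M ℓ) x| := by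
  obtain ⟨c, hc⟩ := (Submodule.mem_span_range_iff_exists_fun ℝ).1 hx
  rcases eq_or_lt_of_le (norm_nonneg x) with h0 | h0
  · rw [← h0, mul_zero]
    positivity
  have hcle : ∀ ℓ, β * |c ℓ| ≤ ‖x‖ := fun ℓ => by
    have h1 := h.inner_sum_smul c ℓ
    rw [hc] at h1
    have h2 := abs_real_inner_le_norm (e ℓ) x
    rw [h1, h.norm_eq_one, one_mul, abs_mul] at h2
    have h3 := (h.le_inner ℓ).trans (le_abs_self _)
    nlinarith [abs_nonneg (c ℓ)]
  have h1 : ‖x‖ ^ 2 ≤ ∑ ℓ, |c ℓ| * |inner ℝ (M ℓ) x| := by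
    rw [← real_inner_self_eq_norm_sq]
    conv_lhs => rw [← hc, sum_inner, hc]
    refine Finset.sum_le_sum fun ℓ _ => ?_
    rw [real_inner_smul_left, ← abs_mul]
    exact le_abs_self _
  have h2 : ‖x‖ * (β * ‖x‖) ≤ ‖x‖ * ∑ ℓ, |inner ℝ (M ℓ) x| := by
    calc ‖x‖ * (β * ‖x‖) = β * ‖x‖ ^ 2 := by ring
      _ ≤ β * ∑ ℓ, |c ℓ| * |inner ℝ (M ℓ) x| := by gcongr
      _ = ∑ ℓ, (β * |c ℓ|) * |inner ℝ (M ℓ) x| := by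
        rw [Finset.mul_sum]
        exact Finset.sum_congr rfl fun _ _ => by ring
      _ ≤ ∑ ℓ, ‖x‖ * |inner ℝ (M ℓ) x| := by
        gcongr with ℓ
        exact hcle ℓ
      _ = ‖x‖ * ∑ ℓ, |inner ℝ (M ℓ) x| := by rw [Finset.mul_sum]
  exact le_of_mul_le_mul_left h2 h0

theorem le_norm_sub (h : IsDualFamily M β e) {ℓ ℓ' : Fin k} (hne : ℓ' ≠ ℓ) :
    β ≤ ‖M ℓ - M ℓ'‖ := by
  have h1 := real_inner_le_norm (e ℓ) (M ℓ - M ℓ')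
  rw [inner_sub_right, h.inner_eq_zero ℓ ℓ' hne, sub_zero, h.norm_eq_one, one_mul] at h1
  exact (h.le_inner ℓ).trans h1

variable [FiniteDimensional ℝ E]

/-- In the subspace of `V` orthogonal to good approximations of the centers of `F`, the other
centers are still visible. -/
theorem le_norm_starProjection {α μ θ ε : ℝ} (h : IsDualFamily M (α * μ) e) (hk : 2 ≤ k)
    (hα0 : 0 < α) (hα1 : α < 1) (hμ : 0 < μ) (hM : ∀ ℓ, ‖M ℓ‖ ≤ μ) {V : Submodule ℝ E}
    (hV : ∀ x ∈ Submodule.span ℝ (Set.range M), ‖x - V.starProjection x‖ ≤ θ * ‖x‖)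
    (hθ0 : 0 ≤ θ) (hθ : θ ≤ α ^ 2 / (64 * k)) (hε0 : 0 ≤ ε)
    (hε : ε ≤ α ^ 2 * μ / (128 * k))
    {F : Finset (Fin k)} {a : Fin k → E} (ha : ∀ i ∈ F, ‖a i - M i‖ ≤ ε)
    {ℓ ℓ' : Fin k} (hℓ : ℓ ∉ F) (hne : ℓ' ≠ ℓ) (c : SignType) :
    α * μ / 2 ≤
      ‖(V ⊓ (Submodule.span ℝ (a '' F))ᗮ).starProjection (M ℓ + (c : ℝ) • M ℓ')‖ := by
  classical
  have hk2 : (2 : ℝ) ≤ k := by exact_mod_cast hk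
  have hk0 : (0 : ℝ) < k := by linarith
  have hβ : 0 < α * μ := by positivity
  have hkθ : k * θ ≤ α ^ 2 / 64 := by
    rw [le_div_iff₀ (by positivity)] at hθ
    linarith
  have hkε : k * ε ≤ α ^ 2 * μ / 128 := by
    rw [le_div_iff₀ (by positivity)] at hε
    linarith
  have hα2 : α ^ 2 ≤ α := by nlinarith
  have hθ' : θ ≤ α / 128 := by nlinarith
  -- The test vector is v - y: e ℓ projected to V, then made orthogonal to the p i. It lies in the
  -- subspace in question and stays within α/8 of e ℓ.
  set v := V.starProjection (e ℓ) with hv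
  have hev : ‖e ℓ - v‖ ≤ θ := by
    simpa [h.norm_eq_one] using hV _ (h.mem_span ℓ)
  set p : Fin k → E := fun i => V.starProjection (a i) with hp
  set L := Submodule.span ℝ (p '' F) with hL
  set y := L.starProjection v with hy
  have hvV : v ∈ V := V.starProjection_apply_mem _
  have hLV : L ≤ V := by
    rw [hL, Submodule.span_le]
    rintro _ ⟨i, _, rfl⟩
    exact V.starProjection_apply_mem _
  have hyL : y ∈ L := L.starProjection_apply_mem _
  have hmem : v - y ∈ V ⊓ (Submodule.span ℝ (a '' F))ᗮ := by
    refine ⟨V.sub_mem hvV (hLV hyL), ?_⟩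
    have hle : Submodule.span ℝ (a '' F) ≤ (Submodule.span ℝ {v - y})ᗮ := by
      rw [Submodule.span_le]
      rintro _ ⟨i, hi, rfl⟩
      rw [SetLike.mem_coe, Submodule.mem_orthogonal_singleton_iff_inner_right]
      have h1 : inner ℝ (v - y) (p i) = 0 := by
        have := L.sub_starProjection_mem_orthogonal v
        exact (Submodule.mem_orthogonal' _ _).1 this _ (Submodule.subset_span ⟨i, hi, rfl⟩)
      rwa [hp, ← V.inner_starProjection_left_eq_right,
        V.starProjection_eq_self_iff.2 (V.sub_mem hvV (hLV hyL))] at h1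
    refine (Submodule.mem_orthogonal' _ _).2 fun z hz => ?_
    exact Submodule.mem_orthogonal_singleton_iff_inner_right.1 (hle hz)
  -- With y = ∑ c i p i, ‖y‖² = ∑ c i (p i ⬝ v). Each p i ⬝ v is small because a i is near M i,
  -- which is orthogonal to e ℓ; pairing y with the e i bounds ∑ |c i| by 2k‖y‖/(αμ).
  have hyn : ‖y‖ ≤ 2 * k * (μ * θ + 2 * ε) / (α * μ) := by
    have hL' : L = Submodule.span ℝ (Set.range fun i : F => p i) := by
      rw [hL, Set.image_eq_range]
      rfl
    obtain ⟨c, hc⟩ := (Submodule.mem_span_range_iff_exists_fun ℝ).1 (hL' ▸ hyL)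
    have hpM : ∀ i ∈ F, ‖p i - M i‖ ≤ ε + θ * μ := by
      intro i hi
      have h1 : p i - M i = V.starProjection (a i - M i) - (M i - V.starProjection (M i)) := by
        rw [map_sub, hp]; abel
      have h2 := hV (M i) (Submodule.subset_span ⟨i, rfl⟩)
      rw [h1]
      refine (norm_sub_le _ _).trans (add_le_add ?_ (h2.trans (by gcongr; exact hM i)))
      exact (Submodule.norm_starProjection_apply_le _ _).trans (ha i hi)
    have hpv : ∀ i ∈ F, |inner ℝ (p i) v| ≤ μ * θ + 2 * ε := by
      intro i hi
      have hil : i ≠ ℓ := fun h => hℓ (h ▸ hi)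
      have h1 : inner ℝ (p i) v = inner ℝ (a i - M i) v - inner ℝ (M i) (e ℓ - v) := by
        rw [hp, V.inner_starProjection_left_eq_right, V.starProjection_eq_self_iff.2 hvV,
          inner_sub_left, inner_sub_right, real_inner_comm (e ℓ) (M i), h.inner_eq_zero ℓ i hil]
        ring
      have h2 := abs_real_inner_le_norm (a i - M i) v
      have h3 := abs_real_inner_le_norm (M i) (e ℓ - v)
      have h4 : ‖v‖ ≤ 1 := by
        have := Submodule.norm_starProjection_apply_le V (e ℓ)
        rwa [h.norm_eq_one] at this
      have h5 : ‖a i - M i‖ * ‖v‖ ≤ ε * 1 :=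
        mul_le_mul (ha i hi) h4 (norm_nonneg _) hε0
      have h6 : ‖M i‖ * ‖e ℓ - v‖ ≤ μ * θ := mul_le_mul (hM i) hev (norm_nonneg _) hμ.le
      rw [h1]
      refine (abs_sub _ _).trans ?_
      linarith
    set C := ∑ i : F, |c i| with hC
    have hC0 : 0 ≤ C := Finset.sum_nonneg fun _ _ => abs_nonneg _
    have hci : ∀ i : F, α * μ * |c i| ≤ ‖y‖ + C * (ε + θ * μ) := by
      intro i
      have h1 : inner ℝ (e i) y = c i * inner ℝ (e i) (M i) +
          ∑ j : F, c j * inner ℝ (e i) (p j - M j) := by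
        rw [← hc, inner_sum]
        have : ∀ j : F, inner ℝ (e i) (c j • p j) =
            c j * inner ℝ (e i) (M j) + c j * inner ℝ (e i) (p j - M j) := fun j => by
          rw [real_inner_smul_right, inner_sub_right]; ring
        simp_rw [this, Finset.sum_add_distrib]
        congr 1
        rw [Finset.sum_eq_single i]
        · intro j _ hji
          rw [h.inner_eq_zero i j (fun h => hji (Subtype.ext h)), mul_zero]
        · simp
      have h2 : |∑ j : F, c j * inner ℝ (e i) (p j - M j)| ≤ C * (ε + θ * μ) := by
        rw [hC, Finset.sum_mul]
        refine (Finset.abs_sum_le_sum_abs _ _).trans (Finset.sum_le_sum fun j _ => ?_)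
        rw [abs_mul]
        refine mul_le_mul_of_nonneg_left ?_ (abs_nonneg _)
        refine (abs_real_inner_le_norm _ _).trans ?_
        rw [h.norm_eq_one, one_mul]
        exact hpM j j.2
      have h3 := abs_real_inner_le_norm (e i) y
      rw [h.norm_eq_one, one_mul] at h3
      have h4 : |c i| * |inner ℝ (e i) (M i)| ≤ ‖y‖ + C * (ε + θ * μ) := by
        rw [← abs_mul]
        have : c i * inner ℝ (e i) (M i) =
            inner ℝ (e i) y - ∑ j : F, c j * inner ℝ (e i) (p j - M j) := by rw [h1]; ring
        rw [this]
        refine (abs_sub _ _).trans ?_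
        linarith
      have h5 := (h.le_inner i).trans (le_abs_self _)
      nlinarith [abs_nonneg (c i)]
    have hCle : C ≤ 2 * k * ‖y‖ / (α * μ) := by
      have hcard : ((Finset.univ : Finset F).card : ℝ) ≤ k := by
        rw [Finset.card_univ, Fintype.card_coe]
        exact_mod_cast (card_finset_fin_le F)
      have h1 : α * μ * C ≤ k * (‖y‖ + C * (ε + θ * μ)) := by
        rw [hC, Finset.mul_sum]
        refine (Finset.sum_le_sum fun i _ => hci i).trans ?_
        rw [Finset.sum_const, nsmul_eq_mul]
        gcongr
      have h2 : k * (ε + θ * μ) ≤ α * μ / 2 := by nlinarith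
      have h3 := mul_le_mul_of_nonneg_left h2 hC0
      rw [le_div_iff₀ hβ]
      linarith
    have hy2 : ‖y‖ ^ 2 ≤ C * (μ * θ + 2 * ε) := by
      have h1 : ‖y‖ ^ 2 = inner ℝ y v := by
        rw [← real_inner_self_eq_norm_sq]
        conv_lhs => rw [hy, L.inner_starProjection_left_eq_right,
          L.starProjection_eq_self_iff.2 (L.starProjection_apply_mem v)]
        rw [real_inner_comm]
      rw [h1, ← hc, sum_inner, hC, Finset.sum_mul]
      refine Finset.sum_le_sum fun i _ => ?_
      rw [real_inner_smul_left]
      refine (le_abs_self _).trans ?_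
      rw [abs_mul]
      exact mul_le_mul_of_nonneg_left (hpv i i.2) (abs_nonneg _)
    have hB : 0 ≤ μ * θ + 2 * ε := by positivity
    rcases eq_or_lt_of_le (norm_nonneg y) with h0 | h0
    · rw [← h0]; positivity
    · refine le_of_mul_le_mul_left ?_ h0
      calc ‖y‖ * ‖y‖ = ‖y‖ ^ 2 := by ring
        _ ≤ C * (μ * θ + 2 * ε) := hy2
        _ ≤ 2 * k * ‖y‖ / (α * μ) * (μ * θ + 2 * ε) := by gcongr
        _ = ‖y‖ * (2 * k * (μ * θ + 2 * ε) / (α * μ)) := by ring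
  have hyα : ‖y‖ ≤ α / 16 := by
    refine hyn.trans ?_
    rw [div_le_iff₀ hβ]
    nlinarith
  have hclose : ‖e ℓ - (v - y)‖ ≤ α / 8 := by
    have : e ℓ - (v - y) = (e ℓ - v) + y := by abel
    rw [this]
    refine (norm_add_le _ _).trans ?_
    linarith
  have hn : ‖v - y‖ ≤ 9 / 8 := by
    have : v - y = e ℓ - (e ℓ - (v - y)) := by abel
    rw [this]
    refine (norm_sub_le _ _).trans ?_
    rw [h.norm_eq_one]
    linarith
  set x := M ℓ + (c : ℝ) • M ℓ' with hx
  have hxn : ‖x‖ ≤ 2 * μ := by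
    have hc : |(c : ℝ)| ≤ 1 := by cases c <;> simp
    refine (norm_add_le _ _).trans ?_
    rw [norm_smul, Real.norm_eq_abs]
    nlinarith [hM ℓ, hM ℓ', norm_nonneg (M ℓ'), abs_nonneg (c : ℝ)]
  have hex : α * μ ≤ inner ℝ (e ℓ) x := by
    rw [hx, inner_add_right, real_inner_smul_right, h.inner_eq_zero ℓ ℓ' hne, mul_zero, add_zero]
    exact h.le_inner ℓ
  have h1 : inner ℝ (e ℓ) x = inner ℝ (v - y) x + inner ℝ (e ℓ - (v - y)) x := by
    rw [← inner_add_left]; congr 1; abel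
  have h2 : inner ℝ (e ℓ - (v - y)) x ≤ α / 8 * (2 * μ) :=
    (real_inner_le_norm _ _).trans (mul_le_mul hclose hxn (norm_nonneg _) (by positivity))
  have h3 : inner ℝ (v - y) x ≤
      9 / 8 * ‖(V ⊓ (Submodule.span ℝ (a '' F))ᗮ).starProjection x‖ := by
    rw [← Submodule.starProjection_eq_self_iff.2 hmem,
      Submodule.inner_starProjection_left_eq_right]
    exact (real_inner_le_norm _ _).trans (by gcongr)
  -- αμ - (α/8)(2μ) = 3αμ/4, and (3/4)/(9/8) = 2/3 ≥ 1/2.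
  nlinarith

end IsDualFamily

end Dual


/-! ### Success probability of the rounds. -/

section Rounds

variable {E : Type*} [NormedAddCommGroup E] [InnerProductSpace ℝ E] [FiniteDimensional ℝ E]
  [MeasurableSpace E] [BorelSpace E] {n k : ℕ}

/-- A union bound over the 3k² triples (ℓ, ℓ', c). -/
theorem stdGaussian_gap_fails_le {M : Fin k → E} {U : Submodule ℝ E} {F : Finset (Fin k)}
    {b τ : ℝ} (hk : 1 ≤ k) (hU : Module.finrank ℝ U ≤ k) (hb : 0 < b) (hτ : 0 ≤ τ)
    (h : ∀ ℓ ∉ F, ∀ ℓ', ℓ' ≠ ℓ → ∀ c : SignType,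
      b ≤ ‖U.starProjection (M ℓ + (c : ℝ) • M ℓ')‖) :
    stdGaussian E {g | ¬ ∀ ℓ ∉ F, ∀ ℓ', ℓ' ≠ ℓ → ∀ c : SignType,
      τ < |inner ℝ (NormedSpace.normalize (U.starProjection g)) (M ℓ + (c : ℝ) • M ℓ')|} ≤
        ENNReal.ofReal (3 * k ^ 2 * (2 * τ * √k / b)) := by
  classical
  set B : Fin k × Fin k × SignType → Set E := fun q =>
    if q.1 ∉ F ∧ q.2.1 ≠ q.1 then
      {g | |inner ℝ (NormedSpace.normalize (U.starProjection g))
        (M q.1 + (q.2.2 : ℝ) • M q.2.1)| ≤ τ} else ∅ with hB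
  have hBle : ∀ q, stdGaussian E (B q) ≤ ENNReal.ofReal (2 * τ * √k / b) := by
    intro q
    by_cases hq : q.1 ∉ F ∧ q.2.1 ≠ q.1
    · simp only [hB, if_pos hq]
      exact stdGaussian_abs_inner_normalize_le (by exact_mod_cast hk) (by exact_mod_cast hU) hb
        (h _ hq.1 _ hq.2 _) hτ
    · simp [hB, if_neg hq]
  have hsub : {g : E | ¬ ∀ ℓ ∉ F, ∀ ℓ', ℓ' ≠ ℓ → ∀ c : SignType,
      τ < |inner ℝ (NormedSpace.normalize (U.starProjection g)) (M ℓ + (c : ℝ) • M ℓ')|} ⊆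
      ⋃ q, B q := by
    intro g hg
    simp only [Set.mem_ofPred_eq, not_forall, not_lt] at hg
    obtain ⟨ℓ, hℓ, ℓ', hne, c, hc⟩ := hg
    refine Set.mem_iUnion.2 ⟨(ℓ, ℓ', c), ?_⟩
    simp only [hB]
    rw [if_pos ⟨hℓ, hne⟩]
    exact hc
  refine (measure_mono hsub).trans ((measure_iUnion_fintype_le _ _).trans
    ((Finset.sum_le_sum fun q _ => hBle q).trans_eq ?_))
  have hcard : Fintype.card SignType = 3 := rfl
  rw [Finset.sum_const, Finset.card_univ, Fintype.card_prod, Fintype.card_prod, Fintype.card_fin,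
    hcard, nsmul_eq_mul, ENNReal.ofReal_mul (by positivity)]
  congr 1
  rw [← ENNReal.ofReal_natCast]
  congr 1
  push_cast
  ring

/-- All `k` rounds recover new centers, except with probability `12 / √k`, when the rounds start
from a subspace close to the span of the centers. -/
theorem pi_stdGaussian_failSet_centers_le {a : Finset (Fin n) → E} {m : ℕ} {M e : Fin k → E}
    {α μ θ ε s : ℝ} (he : IsDualFamily M (α * μ) e) (hk : 2 ≤ k)
    (hα0 : 0 < α) (hα1 : α < 1) (hμ : 0 < μ) (hM : ∀ ℓ, ‖M ℓ‖ ≤ μ) {V : Submodule ℝ E}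
    (hVk : Module.finrank ℝ V ≤ k)
    (hV : ∀ x ∈ Submodule.span ℝ (Set.range M), ‖x - V.starProjection x‖ ≤ θ * ‖x‖)
    (hθ0 : 0 ≤ θ) (hθ : θ ≤ α ^ 2 / (64 * k)) (hε0 : 0 ≤ ε) (hε : ε ≤ α ^ 2 * μ / (128 * k))
    (hετ : ε ≤ α * μ / k ^ 4) (hsε : 12 * s * μ / (α * μ / k ^ 4) + s ≤ ε)
    (hnear : ∀ ℓ, ∃ S, S.card = m ∧ ‖a S - M ℓ‖ ≤ 5 * s)
    (hconv : ∀ S, S.card = m → ∃ w : Fin k → ℝ, (∀ ℓ, 0 ≤ w ℓ) ∧ ∑ ℓ, w ℓ = 1 ∧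
      ‖a S - ∑ ℓ, w ℓ • M ℓ‖ ≤ s) :
    (Measure.pi fun _ : Fin k => stdGaussian E) (failSet a m M ε V ∅ k) ≤
      ENNReal.ofReal (12 / √k) := by
  classical
  have hk2 : (2 : ℝ) ≤ k := by exact_mod_cast hk
  have hk0 : (0 : ℝ) < k := by linarith
  have hβ : 0 < α * μ := by positivity
  -- With this τ a round fails with probability at most 12/k^(3/2).
  set τ := α * μ / k ^ 4 with hτ
  have hτ0 : 0 < τ := by positivity
  set p := ENNReal.ofReal (3 * k ^ 2 * (2 * τ * √k / (α * μ / 2))) with hp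
  -- Centers are at least αμ apart, so a point is ε-close to at most one of them.
  have hε2 : 2 * ε < α * μ := by
    have : α ^ 2 * μ / (128 * k) ≤ α * μ / 128 := by
      rw [div_le_div_iff₀ (by positivity) (by norm_num)]
      have h1 : α ^ 2 ≤ α := by nlinarith
      have h2 : α ^ 2 * μ ≤ α * μ := by gcongr
      have h3 : α * μ * 1 ≤ α * μ * k := by gcongr; linarith
      linarith
    linarith
  -- The invariant remembers only that U is the part of V orthogonal to some ε-approximations of the
  -- centers in F.
  have key := pi_stdGaussian_failSet_le (a := a) (m := m) (M := M) (ε := ε) (p := p)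
    (fun U F => ∃ a' : Fin k → E, (∀ i ∈ F, ‖a' i - M i‖ ≤ ε) ∧
      U = V ⊓ (Submodule.span ℝ (a' '' F))ᗮ) ?_ ?_ ?_ k V ∅ ⟨M, by simp, by simp⟩ (by simp)
  · refine key.trans_eq ?_
    rw [hp, ← ENNReal.ofReal_natCast, ← ENNReal.ofReal_mul (by positivity)]
    congr 1
    have hs : √(k : ℝ) * √k = k := Real.mul_self_sqrt hk0.le
    have hs0 : 0 < √(k : ℝ) := Real.sqrt_pos.2 hk0
    rw [hτ]
    field_simp
    nlinarith
  · rintro U F ℓ S ⟨a', ha', rfl⟩ hℓ hS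
    have hup : ∀ i ∈ F, Function.update a' ℓ (a S) i = a' i := fun i hi =>
      Function.update_of_ne (fun h : i = ℓ => hℓ (h ▸ hi)) _ _
    refine ⟨Function.update a' ℓ (a S), fun i hi => ?_, ?_⟩
    · rcases Finset.mem_insert.1 hi with rfl | hi
      · simpa using hS
      · rw [hup i hi]
        exact ha' i hi
    · have : Function.update a' ℓ (a S) '' F = a' '' F :=
        Set.image_congr fun i hi => hup i hi
      rw [Finset.coe_insert, Set.image_insert_eq, this, Function.update_self, Submodule.span_insert,
        ← Submodule.inf_orthogonal, inf_assoc, inf_comm (Submodule.span ℝ {a S})ᗮ]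
  · intro x ℓ ℓ' h1 h2
    by_contra hne
    have h3 := he.le_norm_sub (ℓ := ℓ) (ℓ' := ℓ') (Ne.symm hne)
    have h4 : M ℓ - M ℓ' = (x - M ℓ') - (x - M ℓ) := by abel
    rw [h4] at h3
    linarith [norm_sub_le (x - M ℓ') (x - M ℓ)]
  · rintro U F ⟨a', ha', hU⟩ hF
    have hUV : U ≤ V := hU ▸ inf_le_left
    have hfr : Module.finrank ℝ U ≤ k := (Submodule.finrank_mono hUV).trans hVk
    refine (measure_mono fun g hg => ?_).trans (stdGaussian_gap_fails_le (M := M) (F := F)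
      (b := α * μ / 2) (τ := τ) (by omega) hfr (by positivity) hτ0.le fun ℓ hℓ ℓ' hne c => ?_)
    · intro hgap
      refine hg ?_
      set u := NormedSpace.normalize (U.starProjection g) with hu
      have hu1 : ‖u‖ ≤ 1 := by
        rcases eq_or_ne (U.starProjection g) 0 with h0 | h0
        · simp [hu, h0]
        · exact (NormedSpace.norm_normalize h0).le
      have huU : u ∈ U := U.smul_mem _ (U.starProjection_apply_mem g)
      have hfound : ∀ i ∈ F, |inner ℝ u (M i)| ≤ τ := by
        intro i hi
        have h1 : inner ℝ u (a' i) = 0 := by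
          rw [hU] at huU
          exact (Submodule.mem_orthogonal' _ _).1 huU.2 _ (Submodule.subset_span ⟨i, hi, rfl⟩)
        have h2 : inner ℝ u (M i) = -inner ℝ u (a' i - M i) := by
          rw [inner_sub_right, h1]; ring
        rw [h2, abs_neg]
        refine (abs_real_inner_le_norm _ _).trans (le_trans ?_ hετ)
        exact (mul_le_of_le_one_left (norm_nonneg _) hu1).trans (ha' i hi)
      obtain ⟨ℓ, hℓ, h⟩ := exists_center_near_maximizers hk hτ0 hM hu1 hnear hconv hF hfound
        hgap hsε
      exact ⟨ℓ, hℓ, fun S hS => h S hS.1 hS.2⟩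
    · rw [hU]
      exact he.le_norm_starProjection hk hα0 hα1 hμ hM hV hθ0 hθ hε0 hε ha' hℓ hne c

end Rounds


/-! ### Averages and singular values of the data matrix. -/

section Data

variable {d n k : ℕ}

theorem adjoint_colMap_apply (B : Fin n → Pt d) (x : Pt d) (j : Fin n) :
    (ContinuousLinearMap.adjoint (colMap B) x) j = inner ℝ (B j) x := by
  have h := ContinuousLinearMap.adjoint_inner_right (colMap B) (EuclideanSpace.single j 1) x
  rw [EuclideanSpace.inner_single_left, colMap_apply] at h
  simpa [ite_smul] using h

theorem adjoint_colMap_eq_add {A B C : Fin n → Pt d} (h : ∀ j, A j = B j + C j) (x : Pt d) :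
    ContinuousLinearMap.adjoint (colMap A) x =
      ContinuousLinearMap.adjoint (colMap B) x + ContinuousLinearMap.adjoint (colMap C) x := by
  ext j
  rw [PiLp.add_apply, adjoint_colMap_apply, adjoint_colMap_apply, adjoint_colMap_apply, h,
    inner_add_left]

theorem norm_adjoint_colMap_le (B : Fin n → Pt d) (x : Pt d) :
    ‖ContinuousLinearMap.adjoint (colMap B) x‖ ≤ ‖colMap B‖ * ‖x‖ := by
  refine (ContinuousLinearMap.le_opNorm _ _).trans_eq ?_
  rw [LinearIsometryEquiv.norm_map]

/-- Apply the difference matrix to the indicator vector of S, whose norm is √|S|. -/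
theorem norm_avg_sub_avg_le (A B : Fin n → Pt d) {S : Finset (Fin n)} (hS : 0 < S.card) :
    ‖avg A S - avg B S‖ ≤ ‖colMap fun j => A j - B j‖ / √(S.card) := by
  have hm : (0 : ℝ) < S.card := by exact_mod_cast hS
  set x : EuclideanSpace ℝ (Fin n) := WithLp.toLp 2 fun j => if j ∈ S then (1 : ℝ) else 0 with hx
  have hxn : ‖x‖ = √(S.card) := by
    rw [EuclideanSpace.norm_eq]
    congr 1
    simp [hx, ite_pow]
  have hcol : colMap (fun j => A j - B j) x = ∑ j ∈ S, (A j - B j) := by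
    rw [colMap_apply]
    simp [hx]
  have h1 : avg A S - avg B S = (S.card : ℝ)⁻¹ • colMap (fun j => A j - B j) x := by
    rw [avg, avg, hcol, Finset.sum_sub_distrib, smul_sub]
  rw [h1, norm_smul, Real.norm_of_nonneg (by positivity)]
  have h2 := (colMap fun j => A j - B j).le_opNorm x
  rw [hxn] at h2
  calc (S.card : ℝ)⁻¹ * ‖colMap (fun j => A j - B j) x‖
      ≤ (S.card : ℝ)⁻¹ * (‖colMap fun j => A j - B j‖ * √(S.card)) := by gcongr
    _ = ‖colMap fun j => A j - B j‖ * (√(S.card) / S.card) := by ring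
    _ = ‖colMap fun j => A j - B j‖ / √(S.card) := by rw [Real.sqrt_div_self', mul_one_div]

theorem exists_weights_of_mem_convexHull_range {E : Type*} [AddCommGroup E] [Module ℝ E]
    {M : Fin k → E} {x : E} (hx : x ∈ convexHull ℝ (Set.range M)) :
    ∃ w : Fin k → ℝ, (∀ ℓ, 0 ≤ w ℓ) ∧ ∑ ℓ, w ℓ = 1 ∧ ∑ ℓ, w ℓ • M ℓ = x := by
  classical
  have h : convexHull ℝ (Set.range M) ⊆ Fintype.linearCombination ℝ M '' stdSimplex ℝ (Fin k) := by
    refine convexHull_min ?_ ((convex_stdSimplex ℝ (Fin k)).linear_image _)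
    rintro _ ⟨ℓ, rfl⟩
    exact ⟨Pi.single ℓ 1, single_mem_stdSimplex ℝ ℓ, by simp⟩
  obtain ⟨w, hw, rfl⟩ := h hx
  exact ⟨w, hw.1, hw.2, by simp [Fintype.linearCombination_apply]⟩

theorem avg_mem_of_convex {B : Fin n → Pt d} {K : Set (Pt d)} (hK : Convex ℝ K)
    (hB : ∀ j, B j ∈ K) {S : Finset (Fin n)} (hS : 0 < S.card) : avg B S ∈ K := by
  have hm : (0 : ℝ) < S.card := by exact_mod_cast hS
  rw [avg, Finset.smul_sum]
  refine hK.sum_mem (fun _ _ => by positivity) ?_ fun j _ => hB j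
  rw [Finset.sum_const, nsmul_eq_mul, mul_inv_cancel₀ hm.ne']

theorem norm_avg_sub_le {B : Fin n → Pt d} {x : Pt d} {r : ℝ} {S : Finset (Fin n)}
    (hS : 0 < S.card) (hB : ∀ j ∈ S, ‖B j - x‖ ≤ r) : ‖avg B S - x‖ ≤ r := by
  have hm : (0 : ℝ) < S.card := by exact_mod_cast hS
  have h1 : avg B S - x = (S.card : ℝ)⁻¹ • ∑ j ∈ S, (B j - x) := by
    rw [avg, Finset.sum_sub_distrib, smul_sub, Finset.sum_const, ← Nat.cast_smul_eq_nsmul ℝ,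
      smul_smul, inv_mul_cancel₀ hm.ne', one_smul]
  rw [h1, norm_smul, Real.norm_of_nonneg (by positivity), inv_mul_le_iff₀ hm]
  refine (norm_sum_le _ _).trans ((Finset.sum_le_sum hB).trans_eq ?_)
  rw [Finset.sum_const, nsmul_eq_mul]

/-- Keep only the coordinates j ∈ S, where |B j ⬝ x| ≥ (c - r)‖x‖. -/
theorem le_norm_adjoint_colMap {B : Fin n → Pt d} {M : Fin k → Pt d} {r c : ℝ} {x : Pt d}
    {S : Finset (Fin n)} {ℓ : Fin k} (hB : ∀ j ∈ S, ‖B j - M ℓ‖ ≤ r)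
    (hx : c * ‖x‖ ≤ |inner ℝ (M ℓ) x|) (hrc : r ≤ c) :
    √(S.card) * (c - r) * ‖x‖ ≤ ‖ContinuousLinearMap.adjoint (colMap B) x‖ := by
  have hcr : 0 ≤ c - r := by linarith
  refine le_of_sq_le_sq ?_ (norm_nonneg _)
  rw [EuclideanSpace.real_norm_sq_eq, mul_pow, mul_pow, Real.sq_sqrt (Nat.cast_nonneg _)]
  calc (S.card : ℝ) * (c - r) ^ 2 * ‖x‖ ^ 2 = ∑ _j ∈ S, ((c - r) * ‖x‖) ^ 2 := by
        rw [Finset.sum_const, nsmul_eq_mul]; ring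
    _ ≤ ∑ j ∈ S, (ContinuousLinearMap.adjoint (colMap B) x j) ^ 2 := by
        refine Finset.sum_le_sum fun j hj => ?_
        rw [adjoint_colMap_apply, ← sq_abs (inner ℝ (B j) x)]
        refine pow_le_pow_left₀ (by positivity) ?_ 2
        have h1 := abs_real_inner_le_norm (B j - M ℓ) x
        have h2 := mul_le_mul_of_nonneg_right (hB j hj) (norm_nonneg x)
        rw [inner_sub_left, abs_sub_comm] at h1
        have h3 := abs_sub_abs_le_abs_sub (inner ℝ (M ℓ) x) (inner ℝ (B j) x)
        linarith
    _ ≤ ∑ j, (ContinuousLinearMap.adjoint (colMap B) x j) ^ 2 :=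
        Finset.sum_le_sum_of_subset_of_nonneg (Finset.subset_univ _) fun _ _ _ => sq_nonneg _

end Data

/-! ### Choice of parameters and assembly. -/

section Main

variable {d n k : ℕ}

/-- Since 1/81 ≤ e⁻⁴, t ≥ log d gives ρ^t ≤ d⁻⁴, which absorbs k³√d ≤ d⁴; of the other t factors one
ρ is kept. Here k³√d is the condition number K/η of the start. -/
theorem pow_mul_le_self {ρ : ℝ} {t : ℕ} (hρ0 : 0 ≤ ρ) (hρ : ρ ≤ 1 / 81) (ht : 1 ≤ t)
    (hk : 2 ≤ k) (hkd : k ≤ d) (hlog : Real.log d ≤ t) :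
    ρ ^ (2 * t) * (k ^ 3 * √d) ≤ ρ := by
  have hd : (2 : ℝ) ≤ d := by exact_mod_cast hk.trans hkd
  have hkd' : (k : ℝ) ≤ d := by exact_mod_cast hkd
  have hd0 : (0 : ℝ) < d := by linarith
  have h1 : (k : ℝ) ^ 3 * √d ≤ (d : ℝ) ^ 4 := by
    have hsq : √(d : ℝ) ≤ d := by
      rw [Real.sqrt_le_left hd0.le]
      nlinarith
    calc (k : ℝ) ^ 3 * √d ≤ (d : ℝ) ^ 3 * d := by gcongr
      _ = (d : ℝ) ^ 4 := by ring
  have hexp : ρ ≤ Real.exp (-4) := by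
    have h3 : Real.exp 1 < 3 := by linarith [Real.exp_one_lt_d9]
    have h4 : Real.exp 4 ≤ 81 := by
      have : Real.exp 4 = Real.exp 1 ^ 4 := by rw [← Real.exp_nat_mul]; norm_num
      rw [this]
      calc Real.exp 1 ^ 4 ≤ 3 ^ 4 := by gcongr
        _ = 81 := by norm_num
    rw [Real.exp_neg]
    refine hρ.trans ?_
    rw [one_div]
    exact inv_anti₀ (Real.exp_pos _) h4
  have h2 : ρ ^ t ≤ ((d : ℝ) ^ 4)⁻¹ := by
    calc ρ ^ t ≤ Real.exp (-4) ^ t := by gcongr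
      _ = Real.exp (-(4 * t)) := by rw [← Real.exp_nat_mul]; congr 1; ring
      _ ≤ Real.exp (-(4 * Real.log d)) := by gcongr
      _ = ((d : ℝ) ^ 4)⁻¹ := by
        rw [Real.exp_neg]
        congr 1
        rw [show (4 : ℝ) * Real.log d = ((4 : ℕ) : ℝ) * Real.log d by norm_num, Real.exp_nat_mul,
          Real.exp_log hd0]
  have h3 : ρ ^ (2 * t) ≤ ρ * ρ ^ t := by
    rw [← pow_succ']
    exact pow_le_pow_of_le_one hρ0 (by linarith) (by omega)
  calc ρ ^ (2 * t) * (k ^ 3 * √d) ≤ (ρ * ((d : ℝ) ^ 4)⁻¹) * (d : ℝ) ^ 4 := by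
        gcongr
        exact h3.trans (by gcongr)
    _ = ρ := by rw [mul_assoc, inv_mul_cancel₀ (by positivity), mul_one]

/-- A failing run of LKS yields a failing sequence of rounds. -/
theorem mem_failSet_of_not_recovers {A : Fin n → Pt d} {m t : ℕ} {M : Fin k → Pt d} {ε : ℝ}
    (hm : m ≤ n) {ω : (Fin k → Pt d) × (Fin k → Pt d)} (h : ¬ Recovers A m t M ε ω) :
    ω.2 ∈ failSet (avg A) m M ε (Submodule.span ℝ (Set.range (powerIter A ω.1 t))) ∅ k := by
  rw [Recovers, not_and] at h
  have h1 := h (exists_isRun A t hm ω)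
  simp only [not_forall] at h1
  obtain ⟨R, hR, hπ⟩ := h1
  refine ⟨R, hR, ?_⟩
  rintro ⟨f, hf, -, hfn⟩
  exact hπ ⟨Equiv.ofBijective f (Finite.injective_iff_bijective.1 hf), hfn⟩

/-- The exceptional set `N` need not be measurable: its measurable hull takes its place. -/
theorem prod_measure_le_add {X Y : Type*} [MeasurableSpace X] [MeasurableSpace Y] (μ : Measure X)
    [IsProbabilityMeasure μ] (ν : Measure Y) [IsProbabilityMeasure ν] {B : Set (X × Y)}
    (hB : MeasurableSet B) (N : Set X) {c : ENNReal}
    (h : ∀ x ∉ N, ν (Prod.mk x ⁻¹' B) ≤ c) : μ.prod ν B ≤ μ N + c := by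
  rw [Measure.prod_apply hB]
  calc ∫⁻ x, ν (Prod.mk x ⁻¹' B) ∂μ
      ≤ ∫⁻ x, ((toMeasurable μ N).indicator (fun _ => 1) x + c) ∂μ := by
        refine lintegral_mono fun x => ?_
        by_cases hx : x ∈ N
        · simp only [Set.indicator_of_mem (subset_toMeasurable μ N hx)]
          exact prob_le_one.trans le_self_add
        · exact (h x hx).trans le_add_self
    _ = μ N + c := by
        rw [lintegral_add_right _ measurable_const,
          lintegral_indicator_const (measurableSet_toMeasurable μ N), measure_toMeasurable]
        simp

/-- s/(αμ/k - 5s) bounds the ratio of the stretching off the span of the centers to that on it. The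
bound 1/81 serves the power iteration, the last one the closeness of V required by the rounds. -/
theorem noise_ratio_bounds {k : ℕ} {α μ s : ℝ} (hk : 2 ≤ k) (hα0 : 0 < α) (hα1 : α < 1) (hμ : 0 < μ)
    (hs0 : 0 ≤ s) (hsμ : s ≤ α ^ 3 * μ / (4500 * k ^ 9)) :
    0 < α * μ / k - 5 * s ∧ s / (α * μ / k - 5 * s) ≤ 1 / 81 ∧
      3 * (s / (α * μ / k - 5 * s)) ≤ α ^ 2 / (64 * k) := by
  have hk2 : (2 : ℝ) ≤ k := by exact_mod_cast hk
  have hk0 : (0 : ℝ) < k := by linarith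
  have hsk : s * (4500 * k ^ 9) ≤ α ^ 3 * μ := by rwa [le_div_iff₀ (by positivity)] at hsμ
  have hp8 : (256 : ℝ) ≤ (k : ℝ) ^ 8 := by
    calc (256 : ℝ) = 2 ^ 8 := by norm_num
      _ ≤ (k : ℝ) ^ 8 := by gcongr
  have hα31 : α ^ 3 ≤ α := by nlinarith [sq_nonneg α, mul_pos hα0 hα0]
  have hks : 4500 * (k ^ 8 * (k * s)) ≤ α ^ 3 * μ := by nlinarith
  have hks1 : 10 * (k * s) ≤ α * μ := by
    have h1 : (256 : ℝ) * (k * s) ≤ k ^ 8 * (k * s) := by gcongr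
    have h2 : α ^ 3 * μ ≤ α * μ := by gcongr
    nlinarith [mul_nonneg hk0.le hs0]
  obtain ⟨γ, hγ⟩ : ∃ γ, γ = α * μ / k - 5 * s := ⟨_, rfl⟩
  rw [← hγ]
  have hγle : α * μ / (2 * k) ≤ γ := by
    have h1 : 5 * s ≤ α * μ / (2 * k) := by
      rw [le_div_iff₀ (by positivity)]
      linarith
    have h2 : α * μ / k = α * μ / (2 * k) + α * μ / (2 * k) := by field_simp; ring
    linarith
  have hγ0 : 0 < γ := lt_of_lt_of_le (by positivity) hγle
  obtain ⟨ρ, hρ⟩ : ∃ ρ, ρ = s / γ := ⟨_, rfl⟩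
  rw [← hρ]
  have hρ0 : 0 ≤ ρ := by rw [hρ]; positivity
  have hρle : ρ ≤ 2 * α ^ 2 / (4500 * k ^ 8) := by
    have h1 : ρ ≤ s / (α * μ / (2 * k)) := by rw [hρ]; gcongr
    refine h1.trans ?_
    rw [div_le_div_iff₀ (by positivity) (by positivity)]
    calc s * (4500 * k ^ 8) = 4500 * (k ^ 8 * (k * s)) / k := by field_simp
      _ ≤ α ^ 3 * μ / k := by gcongr
      _ = 2 * α ^ 2 * (α * μ / (2 * k)) := by field_simp
  have hρ81 : ρ ≤ 1 / 81 := by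
    refine hρle.trans ?_
    rw [div_le_div_iff₀ (by positivity) (by norm_num)]
    nlinarith
  have hθ : 3 * ρ ≤ α ^ 2 / (64 * k) := by
    have h1 : 3 * (2 * α ^ 2 / (4500 * k ^ 8)) ≤ α ^ 2 / (64 * k) := by
      rw [← mul_div_assoc, div_le_div_iff₀ (by positivity) (by positivity)]
      have h2 : (k : ℝ) ≤ k ^ 8 := le_self_pow₀ (by linarith) (by norm_num)
      have h3 : 0 < α ^ 2 := by positivity
      nlinarith
    linarith
  exact ⟨hγ0, hρ81, hθ⟩

theorem recovery_error_bounds {k : ℕ} {α μ s : ℝ} (hk : 2 ≤ k) (hα0 : 0 < α) (hα1 : α < 1) (hμ : 0 < μ)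
    (hs0 : 0 ≤ s) (hsμ : s ≤ α ^ 3 * μ / (4500 * k ^ 9)) :
    150 * (k : ℝ) ^ 4 / α * s ≤ α ^ 2 * μ / (128 * k) ∧
      150 * (k : ℝ) ^ 4 / α * s ≤ α * μ / k ^ 4 ∧
      12 * s * μ / (α * μ / k ^ 4) + s ≤ 150 * (k : ℝ) ^ 4 / α * s := by
  have hk2 : (2 : ℝ) ≤ k := by exact_mod_cast hk
  have hk0 : (0 : ℝ) < k := by linarith
  have hp4 : (16 : ℝ) ≤ (k : ℝ) ^ 4 := by
    calc (16 : ℝ) = 2 ^ 4 := by norm_num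
      _ ≤ (k : ℝ) ^ 4 := by gcongr
  obtain ⟨ε, hε⟩ : ∃ ε, ε = 150 * (k : ℝ) ^ 4 / α * s := ⟨_, rfl⟩
  rw [← hε]
  have hε0 : 0 ≤ ε := by rw [hε]; positivity
  have hε5 : ε ≤ α ^ 2 * μ / (30 * k ^ 5) := by
    rw [hε]
    calc 150 * (k : ℝ) ^ 4 / α * s ≤ 150 * (k : ℝ) ^ 4 / α * (α ^ 3 * μ / (4500 * k ^ 9)) := by
          gcongr
      _ = α ^ 2 * μ / (30 * k ^ 5) := by field_simp; norm_num
  have hε128 : ε ≤ α ^ 2 * μ / (128 * k) := by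
    refine hε5.trans (div_le_div_of_nonneg_left (by positivity) (by positivity) ?_)
    have h1 : (k : ℝ) ^ 5 = k ^ 4 * k := by ring
    nlinarith
  have hετ : ε ≤ α * μ / k ^ 4 := by
    refine hε5.trans ?_
    gcongr
    · exact pow_le_of_le_one hα0.le hα1.le (by norm_num)
    · have h1 : (k : ℝ) ^ 5 = k ^ 4 * k := by ring
      nlinarith
  have hsε : 12 * s * μ / (α * μ / k ^ 4) + s ≤ ε := by
    have h1 : 12 * s * μ / (α * μ / k ^ 4) = 12 * (k ^ 4 / α * s) := by field_simp
    have h2 : s ≤ k ^ 4 / α * s := by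
      refine le_mul_of_one_le_left hs0 ?_
      rw [le_div_iff₀ hα0]
      linarith
    have h3 : ε = 150 * (k ^ 4 / α * s) := by rw [hε]; ring
    rw [h1, h3]
    have h4 : 0 ≤ k ^ 4 / α * s := hs0.trans h2
    linarith
  exact ⟨hε128, hετ, hsε⟩

/-- For x in the span, some center has |M ℓ ⬝ x| ≥ (β/k)‖x‖, and the m columns B j, j ∈ S ℓ, are
within 4s of it; A - B costs one more s. Orthogonally to the span only A - B acts. -/
theorem singular_value_bounds {m : ℕ} {β s : ℝ} {M e : Fin k → Pt d} {A B : Fin n → Pt d}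
    {S : Fin k → Finset (Fin n)} (hk : 0 < k) (hm : 0 < m) (hβ : 0 < β) (hs0 : 0 ≤ s)
    (he : IsDualFamily M β e) (hs : s = ‖colMap fun j => A j - B j‖ / √m)
    (hB : ∀ j, B j ∈ convexHull ℝ (Set.range M)) (hS : ∀ ℓ, (S ℓ).card = m)
    (hBS : ∀ ℓ, ∀ j ∈ S ℓ, ‖B j - M ℓ‖ ≤ 4 * s) (hγ0 : 0 < β / k - 5 * s) :
    (∀ x ∈ Submodule.span ℝ (Set.range M),
      √m * (β / k - 5 * s) * ‖x‖ ≤ ‖ContinuousLinearMap.adjoint (colMap A) x‖) ∧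
    ∀ x ∈ (Submodule.span ℝ (Set.range M))ᗮ,
      ‖ContinuousLinearMap.adjoint (colMap A) x‖ ≤ s * √m * ‖x‖ := by
  have hk0 : (0 : ℝ) < k := by exact_mod_cast hk
  have hsm0 : 0 < √(m : ℝ) := Real.sqrt_pos.2 (by exact_mod_cast hm)
  set T := Submodule.span ℝ (Set.range M) with hT
  obtain ⟨γ, hγ⟩ : ∃ γ, γ = β / k - 5 * s := ⟨_, rfl⟩
  rw [← hγ] at hγ0 ⊢
  set ν := ‖colMap fun j => A j - B j‖ with hν
  have hνs : ν = s * √m := by rw [hs]; field_simp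
  have hadd : ∀ x, ContinuousLinearMap.adjoint (colMap A) x =
      ContinuousLinearMap.adjoint (colMap B) x +
        ContinuousLinearMap.adjoint (colMap fun j => A j - B j) x :=
    adjoint_colMap_eq_add fun j => (add_sub_cancel _ _).symm
  have hBT : ∀ j, B j ∈ T := fun j =>
    convexHull_min Submodule.subset_span (Submodule.convex T) (hB j)
  have hlow : ∀ x ∈ T, √m * γ * ‖x‖ ≤ ‖ContinuousLinearMap.adjoint (colMap A) x‖ := by
    intro x hx
    have hne : (Finset.univ : Finset (Fin k)).Nonempty := ⟨⟨0, hk⟩, Finset.mem_univ _⟩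
    obtain ⟨ℓ, -, hℓ⟩ := Finset.exists_le_of_sum_le hne (f := fun _ : Fin k => β / k * ‖x‖)
      (g := fun ℓ => |inner ℝ (M ℓ) x|) (by
        refine le_trans (le_of_eq ?_) (he.le_sum_abs_inner hβ hx)
        rw [Finset.sum_const, Finset.card_univ, Fintype.card_fin, nsmul_eq_mul]
        field_simp)
    have h1 := le_norm_adjoint_colMap (hBS ℓ) hℓ (by linarith)
    rw [hS] at h1
    have h2 := norm_adjoint_colMap_le (fun j => A j - B j) x
    rw [← hν, hνs] at h2
    have h3 : ContinuousLinearMap.adjoint (colMap B) x =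
        ContinuousLinearMap.adjoint (colMap A) x -
          ContinuousLinearMap.adjoint (colMap fun j => A j - B j) x := by rw [hadd]; abel
    rw [h3] at h1
    have h4 := norm_sub_le (ContinuousLinearMap.adjoint (colMap A) x)
      (ContinuousLinearMap.adjoint (colMap fun j => A j - B j) x)
    have h5 : √(m : ℝ) * γ * ‖x‖ = √m * (β / k - 4 * s) * ‖x‖ - s * √m * ‖x‖ := by
      rw [hγ]; ring
    linarith
  have hup : ∀ x ∈ Tᗮ, ‖ContinuousLinearMap.adjoint (colMap A) x‖ ≤ s * √m * ‖x‖ := by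
    intro x hx
    have h0 : ContinuousLinearMap.adjoint (colMap B) x = 0 := by
      ext j
      rw [adjoint_colMap_apply, (Submodule.mem_orthogonal _ _).1 hx _ (hBT j)]
      rfl
    rw [hadd, h0, zero_add, ← hνs]
    exact norm_adjoint_colMap_le _ _
  exact ⟨hlow, hup⟩

theorem bitsLaw_not_recovers_le {m t : ℕ} {α s μ : ℝ} {M e : Fin k → Pt d}
    {A B : Fin n → Pt d} {S : Fin k → Finset (Fin n)} (hk : 2 ≤ k) (hm : 0 < m)
    (hα0 : 0 < α) (hα1 : α < 1) (hμ : 0 < μ) (hM : ∀ ℓ, ‖M ℓ‖ ≤ μ)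
    (he : IsDualFamily M (α * μ) e)
    (hs : s = ‖colMap fun j => A j - B j‖ / √m) (hsμ : s ≤ α ^ 3 * μ / (4500 * k ^ 9))
    (hB : ∀ j, B j ∈ convexHull ℝ (Set.range M)) (hS : ∀ ℓ, (S ℓ).card = m)
    (hBS : ∀ ℓ, ∀ j ∈ S ℓ, ‖B j - M ℓ‖ ≤ 4 * s) (ht : Real.log d ≤ t) :
    bitsLaw d k {ω | ¬ Recovers A m t M (150 * (k : ℝ) ^ 4 / α * s) ω} ≤
      ENNReal.ofReal (14 / √k) := by
  have hk2 : (2 : ℝ) ≤ k := by exact_mod_cast hk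
  have hk0 : (0 : ℝ) < k := by linarith
  have hm0 : (0 : ℝ) < m := by exact_mod_cast hm
  have hsm0 : 0 < √(m : ℝ) := Real.sqrt_pos.2 hm0
  have hβ : 0 < α * μ := by positivity
  have hs0 : 0 ≤ s := by rw [hs]; positivity
  have hmn : m ≤ n := by
    have := Finset.card_le_univ (S ⟨0, by omega⟩)
    rwa [hS, Fintype.card_fin] at this
  set T := Submodule.span ℝ (Set.range M) with hT
  have hTk : Module.finrank ℝ T = k := by
    simpa using finrank_span_eq_card (he.linearIndependent hβ)
  have hkd : k ≤ d := by
    have := T.finrank_le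
    rwa [hTk, finrank_euclideanSpace_fin] at this
  have hd2 : (2 : ℝ) ≤ d := by exact_mod_cast hk.trans hkd
  have ht1 : 1 ≤ t := by
    have : (0 : ℝ) < t := (Real.log_pos (by linarith)).trans_le ht
    exact_mod_cast this
  obtain ⟨hγ0, hρ81, hθ⟩ := noise_ratio_bounds hk hα0 hα1 hμ hs0 hsμ
  obtain ⟨hε128, hετ, hsε⟩ := recovery_error_bounds hk hα0 hα1 hμ hs0 hsμ
  obtain ⟨hlow, hup⟩ := singular_value_bounds (by omega) hm hβ hs0 he hs hB hS hBS hγ0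
  have hε0 : 0 ≤ 150 * (k : ℝ) ^ 4 / α * s := by positivity
  set ε := 150 * (k : ℝ) ^ 4 / α * s with hε
  clear_value ε
  obtain ⟨γ, hγ⟩ : ∃ γ, γ = α * μ / k - 5 * s := ⟨_, rfl⟩
  rw [← hγ] at hγ0 hρ81 hθ hlow
  obtain ⟨ρ, hρ⟩ : ∃ ρ, ρ = s / γ := ⟨_, rfl⟩
  rw [← hρ] at hρ81 hθ
  have hρ0 : 0 ≤ ρ := by rw [hρ]; positivity
  have hsγ : s < γ := by
    rw [← div_lt_one hγ0, ← hρ]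
    linarith
  have hAB : ∀ R : Finset (Fin n), R.card = m → ‖avg A R - avg B R‖ ≤ s := fun R hR => by
    have := norm_avg_sub_avg_le A B (S := R) (by omega)
    rwa [hR, ← hs] at this
  have hnear : ∀ ℓ, ∃ R, R.card = m ∧ ‖avg A R - M ℓ‖ ≤ 5 * s := fun ℓ => by
    refine ⟨S ℓ, hS ℓ, ?_⟩
    have h1 := norm_avg_sub_le (by rw [hS]; exact hm) (hBS ℓ)
    have h2 := norm_sub_le_norm_sub_add_norm_sub (avg A (S ℓ)) (avg B (S ℓ)) (M ℓ)
    linarith [hAB (S ℓ) (hS ℓ)]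
  have hconv : ∀ R : Finset (Fin n), R.card = m → ∃ w : Fin k → ℝ, (∀ ℓ, 0 ≤ w ℓ) ∧
      ∑ ℓ, w ℓ = 1 ∧ ‖avg A R - ∑ ℓ, w ℓ • M ℓ‖ ≤ s := fun R hR => by
    obtain ⟨w, hw0, hw1, hw⟩ := exists_weights_of_mem_convexHull_range
      (avg_mem_of_convex (convex_convexHull ℝ _) hB (S := R) (by omega))
    exact ⟨w, hw0, hw1, hw ▸ hAB R hR⟩
  obtain ⟨W, hWk, hW⟩ := exists_good_start_subspace (colMap A) T (ε := s * √m) (s := √m * γ)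
    (by positivity) (by rw [mul_comm]; gcongr) hlow hup
  have hρ' : s * √m / (√m * γ) = ρ := by rw [hρ]; field_simp
  rw [hρ'] at hW
  have hq0 : 0 < √(k : ℝ) := Real.sqrt_pos.2 hk0
  have hq2 : √(k : ℝ) * √k = k := Real.mul_self_sqrt hk0.le
  have hD0 : 0 < √(d : ℝ) := Real.sqrt_pos.2 (by linarith)
  -- These values give kη = 1/√k and k√d/K = 1/√k, so the start is bad with probability at most
  -- 2/√k.
  set η : ℝ := 1 / (k * √k) with hη
  set K : ℝ := k * √k * √d with hK
  have hη0 : 0 < η := by positivity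
  have hK0 : 0 < K := by positivity
  have hKη : K / η = k ^ 3 * √d := by
    rw [hK, hη, div_div_eq_mul_div, div_one]
    linear_combination (k : ℝ) ^ 2 * √d * hq2
  have hstart := pi_stdGaussian_not_goodStart_le (hWk.trans hTk) hη0.le hK0 hD0
    (by rw [finrank_euclideanSpace_fin, Real.sq_sqrt (Nat.cast_nonneg d)])
  have hgood : ∀ G ∉ {G : Fin k → Pt d | ¬ GoodStart W η K G},
      (Measure.pi fun _ : Fin k => stdGaussian (Pt d))
        (Prod.mk G ⁻¹' {ω | ¬ Recovers A m t M ε ω}) ≤ ENNReal.ofReal (12 / √k) := by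
    intro G hG
    have hG' : GoodStart W η K G := not_not.1 hG
    set V := Submodule.span ℝ (Set.range (powerIter A G t)) with hVdef
    have hVk : Module.finrank ℝ V ≤ k := by
      simpa using! finrank_range_le_card (R := ℝ) (powerIter A G t)
    -- 2ρ comes from the angle between T and W, and at most ρ from stopping after t iterations.
    have hV : ∀ x ∈ T, ‖x - V.starProjection x‖ ≤ 3 * ρ * ‖x‖ := by
      intro x hx
      obtain ⟨v, hv, hxv⟩ := hW hTk η K hη0 hK0.le G hG' t x hx
      rw [← span_powerIter] at hv
      have h1 : x - V.starProjection x = Vᗮ.starProjection (x - v) := by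
        rw [Submodule.starProjection_orthogonal_val, map_sub,
          Submodule.starProjection_eq_self_iff.2 hv]
        abel
      rw [h1]
      refine (Submodule.norm_starProjection_apply_le _ _).trans (hxv.trans ?_)
      gcongr
      have := pow_mul_le_self hρ0 hρ81 ht1 hk hkd ht
      rw [hKη]
      linarith
    refine (measure_mono fun g hg => ?_).trans (pi_stdGaussian_failSet_centers_le he hk hα0 hα1
      hμ hM hVk hV (by positivity) hθ hε0 hε128 hετ hsε hnear hconv)
    exact mem_failSet_of_not_recovers (ω := (G, g)) hmn hg
  have htotal := prod_measure_le_add (Measure.pi fun _ : Fin k => stdGaussian (Pt d))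
    (Measure.pi fun _ : Fin k => stdGaussian (Pt d)) (measurableSet_not_recovers A t hmn M ε) _ hgood
  rw [bitsLaw]
  refine htotal.trans ?_
  refine (add_le_add_left hstart _).trans_eq ?_
  rw [← ENNReal.ofReal_add (by positivity) (by positivity)]
  congr 1
  rw [hη, hK]
  field_simp
  norm_num

end Main

end LatentSimplex

end

/-- `C ℓ` are the clusters, `M ℓ` their centers, `A` the original data, `Δ` the adversarial noise,
and `m = δ n`. The (outer) probability that LKS fails on the noisy data is at most `c / √k`. -/
theorem mainTheorem7 :
    ∃ c c₀ : ℝ, 0 < c ∧ 0 < c₀ ∧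
      ∀ (d n k m : ℕ) (α δ : ℝ) (M : Fin k → LatentSimplex.Pt d)
        (C : Fin k → Finset (Fin n)) (A P Δ : Fin n → LatentSimplex.Pt d)
        (S : Fin k → Finset (Fin n)) (t : ℕ),
        2 ≤ k → 0 < n → 0 < α → α < 1 → 0 < δ → (m : ℝ) = δ * n →
        -- the ground-truth clustering
        (∀ j, ∃! ℓ, j ∈ C ℓ) →
        (∀ ℓ, ∀ j ∈ C ℓ, P j = M ℓ) →
        LatentSimplex.WellSeparated M α →
        (∀ ℓ, δ * n ≤ ((C ℓ).card : ℝ)) →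
        LatentSimplex.SpectrallyBounded M α δ (LatentSimplex.sigma A P) →
        -- the adversarial noise
        (∀ ℓ, S ℓ ⊆ C ℓ ∧ (S ℓ).card = m) →
        (∀ j, P j + Δ j ∈ convexHull ℝ (Set.range M)) →
        (∀ ℓ, ∀ j ∈ S ℓ, ‖Δ j‖ ≤ 4 * LatentSimplex.sigma A P / Real.sqrt δ) →
        -- the number of power iterations
        c₀ * Real.log d ≤ t →
        LatentSimplex.bitsLaw d k
            {ω | ¬ LatentSimplex.Recovers (fun j => A j + Δ j) m t M
              (150 * (k : ℝ) ^ 4 / α * (LatentSimplex.sigma A P / Real.sqrt δ)) ω} ≤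
          ENNReal.ofReal (c / Real.sqrt k) := by
  refine ⟨14, 1, by norm_num, by norm_num, ?_⟩
  intro d n k m α δ M C A P Δ S t hk hn hα0 hα1 hδ hm _ hP hsep _ hspec hS hconv hΔ ht
  have hn0 : (0 : ℝ) < n := by exact_mod_cast hn
  have hm0 : 0 < m := by
    have : (0 : ℝ) < m := by rw [hm]; positivity
    exact_mod_cast this
  have hσ : LatentSimplex.sigma A P / √δ =
      ‖LatentSimplex.colMap fun j => (A j + Δ j) - (P j + Δ j)‖ / √m := by
    simp_rw [add_sub_add_right_eq_sub]
    rw [LatentSimplex.sigma, div_div, hm, mul_comm δ, Real.sqrt_mul hn0.le]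
  have hσ0 : 0 ≤ LatentSimplex.sigma A P / √δ := by rw [hσ]; positivity
  obtain ⟨ℓ₀, -, hmax⟩ := Finset.exists_max_image Finset.univ (fun ℓ => ‖M ℓ‖)
    ⟨⟨0, by omega⟩, Finset.mem_univ _⟩
  have hM : ∀ ℓ, ‖M ℓ‖ ≤ ‖M ℓ₀‖ := fun ℓ => hmax ℓ (Finset.mem_univ _)
  -- If all centers vanish, well-separatedness gives no positive constant. The spectral bound then
  -- forces σ/√δ = 0, so every average of m observed points is exactly 0 and no run can fail.
  rcases eq_or_lt_of_le (norm_nonneg (M ℓ₀)) with h0 | hμ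
  · have hM0 : ∀ ℓ, M ℓ = 0 := fun ℓ => norm_le_zero_iff.1 (h0 ▸ hM ℓ)
    have hs0 : LatentSimplex.sigma A P / √δ = 0 := by
      refine le_antisymm ?_ hσ0
      simpa [hM0] using hspec ℓ₀
    have hmn : m ≤ n := by
      have := Finset.card_le_univ (S ℓ₀)
      rwa [(hS ℓ₀).2, Fintype.card_fin] at this
    have hempty : {ω | ¬ LatentSimplex.Recovers (fun j => A j + Δ j) m t M
        (150 * (k : ℝ) ^ 4 / α * (LatentSimplex.sigma A P / √δ)) ω} = ∅ := by
      ext ω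
      simp only [Set.mem_ofPred_eq, Set.mem_empty_iff_false, iff_false, not_not]
      refine ⟨LatentSimplex.exists_isRun _ t hmn ω, fun R hR => ⟨1, fun ℓ => ?_⟩⟩
      have hcard := (hR ℓ).1
      have h1 := LatentSimplex.norm_avg_sub_avg_le (fun j => A j + Δ j) (fun j => P j + Δ j)
        (S := R ℓ) (by omega)
      obtain ⟨w, -, -, hw⟩ := LatentSimplex.exists_weights_of_mem_convexHull_range
        (LatentSimplex.avg_mem_of_convex (convex_convexHull ℝ _) hconv (S := R ℓ) (by omega))
      rw [hcard, ← hσ, hs0, ← hw] at h1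
      simpa [hM0, hs0] using h1
    rw [hempty, MeasureTheory.measure_empty]
    exact zero_le
  · obtain ⟨e, he⟩ := hsep.exists_isDualFamily ℓ₀ (by positivity)
    refine LatentSimplex.bitsLaw_not_recovers_le (B := fun j => P j + Δ j) hk hm0 hα0 hα1 hμ hM he
      hσ (hspec ℓ₀) hconv (fun ℓ => (hS ℓ).2) (fun ℓ j hj => ?_) (by simpa using ht)
    rw [hP ℓ j ((hS ℓ).1 hj), add_sub_cancel_left, ← mul_div_assoc]
    exact hΔ ℓ j hj
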